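/- All graphs are finite and simple. An interval representation $\alpha$ of a graph $G$ assigns to each vertex $v$ a nonempty closed bounded interval $I_v\subseteq\mathbb R$ so that distinct $v,w$ are adjacent iff $I_v\cap I_w\neq\emptyset$; $G$ is an interval graph iff it has one. For a vertex $z$, $\operatorname{imp}_\alpha(z)$ is the number of vertices $w\ne z$ with $I_w\subseteq I_z$; $\operatorname{imp}(\alpha)=\max_z \operatorname{imp}_\alpha(z)$, and the impropriety of an interval graph $G$ is $\operatorname{imp}(G)=\min_\alpha\operatorname{imp}(\alpha)$. (For the graph without vertices these are $0$.) For a positive integer $p$, an interval graph $G$ is $p$-critical iff $\operatorname{imp}(G)=p$ and every proper induced subgraph of $G$ has impropriety less than $p$. The local components at a vertex $z$ of $G$ are the connected components of $G\setminus\{z\}$; a local component is exterior iff it contains a vertex not adjacent to $z$. If $z$ has $n$ local components, the weight $\operatorname{wt}(z)$ is the sum of the $n-2$ smallest orders of the non-exterior local components at $z$ (and $0$ if $n\le 2$); $\operatorname{wt}(G)=\max_z \operatorname{wt}(z)$. An interval graph $G$ is balanced iff $\operatorname{wt}(G)=\operatorname{imp}(G)$. Let $\mathcal H=(H_1,\dots,H_n)$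 be a finite sequence of (nonempty) connected interval graphs. $\mathrm{BAL}_0(\mathcal H)$ is the join of a single vertex $z$ with the disjoint union of the $H_i$. If the maximum order of the $H_i$ is at least $2$, then for $k\ge 1$ the graph $\mathrm{BAL}_k(\mathcal H)$ is obtained from $\mathrm{BAL}_0(\mathcal H)$ by attaching $k$ pendant $P_3$'s at $z$, that is, by adding for each $j=1,\dots,k$ two new vertices $x_j,y_j$ and the two edges $x_jy_j$, $y_jz$. Theorem. A graph $G$ is balanced and $p$-critical for some $p\ge 1$ if and only if at least one of the following holds for some such sequence $\mathcal H$: a) $G$ is isomorphic to $\mathrm{BAL}_0(\mathcal H)$, where at least three of the $H_i$ are cliques whose order is the maximum order of the $H_i$; b) $G$ is isomorphic to $\mathrm{BAL}_1(\mathcal H)$, where the maximum order of the $H_i$ is at least $2$ and at least two of the $H_i$ are cliques whose order is that maximum; c) $G$ is isomorphic to $\mathrm{BAL}_2(\mathcal H)$, where the maximum order of the $H_i$ is at least $2$. -/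

import Mathlib

universe u

namespace ImpInterval

variable {V : Type u}

/-- An interval representation of `G`: every vertex `v` is assigned the nonempty closed interval
`[l v, r v]` of the real line, and distinct vertices are adjacent iff their intervals meet. -/
structure IntervalRep (G : SimpleGraph V) where
  l : V → ℝ
  r : V → ℝ
  l_le_r : ∀ v, l v ≤ r v
  adj_iff : ∀ v w, v ≠ w →
    (G.Adj v w ↔ (Set.Icc (l v) (r v) ∩ Set.Icc (l w) (r w)).Nonempty)

/-- `G` is an interval graph (finiteness is imposed on the vertex type where it is used). -/
def IsIntervalGraph (G : SimpleGraph V) : Prop := Nonempty (IntervalRep G)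

/-- The impropriety of the vertex `z` in a representation: the number of intervals of other
vertices that lie inside the interval of `z`. -/
noncomputable def IntervalRep.impAt {G : SimpleGraph V} (a : IntervalRep G) (z : V) : ℕ :=
  Nat.card {w : V // w ≠ z ∧ Set.Icc (a.l w) (a.r w) ⊆ Set.Icc (a.l z) (a.r z)}

/-- The impropriety of a representation: the maximum over all vertices (`0` if there are none). -/
noncomputable def IntervalRep.imp {G : SimpleGraph V} (a : IntervalRep G) : ℕ :=
  ⨆ z : V, a.impAt z

/-- The impropriety of `G`: the minimum over all representations. It is only meaningful for
finite interval graphs. -/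
noncomputable def imp (G : SimpleGraph V) : ℕ := ⨅ a : IntervalRep G, a.imp

/-- The local components at `z`: the connected components of `G ∖ {z}`. -/
abbrev LocalComponent (G : SimpleGraph V) (z : V) : Type u :=
  (G.induce ({z}ᶜ : Set V)).ConnectedComponent

/-- The order (number of vertices) of a local component. -/
noncomputable def LocalComponent.order {G : SimpleGraph V} {z : V} (C : LocalComponent G z) : ℕ :=
  Nat.card C.supp

/-- A local component at `z` is exterior if it contains a vertex not adjacent to `z`. -/
def LocalComponent.IsExterior {G : SimpleGraph V} {z : V} (C : LocalComponent G z) : Prop :=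
  ∃ v ∈ C.supp, ¬ G.Adj z v

instance [Finite V] (G : SimpleGraph V) (z : V) : Finite (LocalComponent G z) :=
  Quot.finite _

/-- The multiset of the orders of the non-exterior local components at `z`. -/
noncomputable def nonExteriorOrders [Finite V] (G : SimpleGraph V) (z : V) : Multiset ℕ :=
  (Set.toFinite {C : LocalComponent G z | ¬ C.IsExterior}).toFinset.val.map
    LocalComponent.order

/-- The weight of `z`: the sum of the `n - 2` smallest orders of non-exterior local components
at `z`, where `n` is the number of all local components at `z`
(and `0` if `n ≤ 2`, as there is then nothing to sum). -/
noncomputable def wtAt [Finite V] (G : SimpleGraph V) (z : V) : ℕ :=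
  (((nonExteriorOrders G z).sort (· ≤ ·)).take (Nat.card (LocalComponent G z) - 2)).sum

/-- The weight of `G`: the maximum of the weights of its vertices. -/
noncomputable def wt [Finite V] (G : SimpleGraph V) : ℕ := ⨆ z : V, wtAt G z

/-- An interval graph is balanced if its weight equals its impropriety. -/
def IsBalanced [Finite V] (G : SimpleGraph V) : Prop :=
  IsIntervalGraph G ∧ wt G = imp G

/-- `G` is `p`-critical, where `p > 0`: it is an interval graph of impropriety `p` and every
proper induced subgraph has impropriety less than `p`. -/
def IsCritical (G : SimpleGraph V) (p : ℕ) : Prop :=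
  0 < p ∧ IsIntervalGraph G ∧ imp G = p ∧ ∀ S : Set V, S ≠ Set.univ → imp (G.induce S) < p

/-- The vertices of `BAL_k(H)`: the vertex `z`, the vertices of the graphs `H i`, and the two
further vertices `x j` and `y j` of each of the `k` pendant paths `x j — y j — z`. -/
inductive BalVertex {n : ℕ} (W : Fin n → Type u) (k : ℕ) : Type u
  | z : BalVertex W k
  | inner (i : Fin n) (w : W i) : BalVertex W k
  | y (j : Fin k) : BalVertex W k
  | x (j : Fin k) : BalVertex W k

/-- The edges of `BAL_k(H)`, each in at least one orientation. -/
inductive BalRel {n : ℕ} {W : Fin n → Type u} (H : ∀ i, SimpleGraph (W i)) (k : ℕ) :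
    BalVertex W k → BalVertex W k → Prop
  | z_inner (i : Fin n) (w : W i) : BalRel H k .z (.inner i w)
  | inner_inner (i : Fin n) (w w' : W i) (h : (H i).Adj w w') :
      BalRel H k (.inner i w) (.inner i w')
  | z_y (j : Fin k) : BalRel H k .z (.y j)
  | y_x (j : Fin k) : BalRel H k (.y j) (.x j)

/-- `BAL_k(H)`: the join of a vertex `z` with the disjoint union of the graphs `H i`, with `k`
pendant `P₃`s attached at `z`. -/
def BAL {n : ℕ} {W : Fin n → Type u} (k : ℕ) (H : ∀ i, SimpleGraph (W i)) :
    SimpleGraph (BalVertex W k) :=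
  SimpleGraph.fromRel (BalRel H k)

/-- `H` is a sequence of finite connected (in particular nonempty) interval graphs. -/
def IsConnIntervalSeq {n : ℕ} {W : Fin n → Type u} (H : ∀ i, SimpleGraph (W i)) : Prop :=
  ∀ i, Finite (W i) ∧ (H i).Connected ∧ IsIntervalGraph (H i)

/-- At least `c` members of the sequence `H` are cliques of maximum order. -/
def HasMaxCliques {n : ℕ} {W : Fin n → Type u} (H : ∀ i, SimpleGraph (W i)) (c : ℕ) : Prop :=
  ∃ s : Finset (Fin n), s.card = c ∧
    ∀ i ∈ s, H i = ⊤ ∧ ∀ j, Nat.card (W j) ≤ Nat.card (W i)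

/-- The maximum order of the members of `H` is at least `2`; `BAL_k(H)` is considered for
`k ≥ 1` only in this case. -/
def MaxOrderGeTwo {n : ℕ} (W : Fin n → Type u) : Prop := ∃ i, 2 ≤ Nat.card (W i)

end ImpInterval

namespace ImpInterval

section Basic

variable {V : Type u} {V' : Type u} {G : SimpleGraph V} {G' : SimpleGraph V'}

theorem Icc_inter_nonempty_iff {a b c d : ℝ} (h : a ≤ b) (h' : c ≤ d) :
    (Set.Icc a b ∩ Set.Icc c d).Nonempty ↔ a ≤ d ∧ c ≤ b := by
  rw [Set.Icc_inter_Icc, Set.nonempty_Icc, sup_le_iff, le_inf_iff, le_inf_iff]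
  tauto

theorem IntervalRep.adj_iff_le (a : IntervalRep G) {v w : V} (h : v ≠ w) :
    G.Adj v w ↔ a.l v ≤ a.r w ∧ a.l w ≤ a.r v :=
  (a.adj_iff v w h).trans (Icc_inter_nonempty_iff (a.l_le_r v) (a.l_le_r w))

theorem IntervalRep.impAt_eq_ncard (a : IntervalRep G) (z : V) :
    a.impAt z = {w | w ≠ z ∧ a.l z ≤ a.l w ∧ a.r w ≤ a.r z}.ncard := by
  unfold IntervalRep.impAt
  rw [← Nat.card_coe_set_eq]
  congr! 3 with w
  exact and_congr_right fun _ => Set.Icc_subset_Icc_iff (a.l_le_r w)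

/-- The representation with the given endpoints. -/
def IntervalRep.ofEndpoints (l r : V → ℝ) (hlr : ∀ v, l v ≤ r v)
    (h : ∀ v w, v ≠ w → (G.Adj v w ↔ l v ≤ r w ∧ l w ≤ r v)) : IntervalRep G where
  l := l
  r := r
  l_le_r := hlr
  adj_iff v w hvw := (h v w hvw).trans (Icc_inter_nonempty_iff (hlr v) (hlr w)).symm

/-- The restriction of a representation along an embedding. -/
def IntervalRep.comap (a : IntervalRep G') (f : G ↪g G') : IntervalRep G where
  l v := a.l (f v)
  r v := a.r (f v)
  l_le_r v := a.l_le_r (f v)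
  adj_iff _ _ hvw := f.map_rel_iff.symm.trans (a.adj_iff _ _ (f.injective.ne hvw))

theorem IntervalRep.impAt_comap_le [Finite V'] (a : IntervalRep G') (f : G ↪g G') (z : V) :
    (a.comap f).impAt z ≤ a.impAt (f z) := by
  rw [impAt_eq_ncard, impAt_eq_ncard, ← Set.ncard_image_of_injective _ f.injective]
  refine Set.ncard_le_ncard ?_ (Set.toFinite _)
  rintro _ ⟨w, ⟨h1, h2, h3⟩, rfl⟩
  exact ⟨f.injective.ne h1, h2, h3⟩

theorem IsIntervalGraph.of_embedding (h : IsIntervalGraph G') (f : G ↪g G') :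
    IsIntervalGraph G :=
  h.map fun a => a.comap f

theorem imp_le_of_impAt_le (a : IntervalRep G) {p : ℕ} (h : ∀ z, a.impAt z ≤ p) : imp G ≤ p :=
  (ciInf_le (OrderBot.bddBelow _) a).trans (ciSup_le' h)

theorem IntervalRep.impAt_le_imp [Finite V] (a : IntervalRep G) (z : V) : a.impAt z ≤ a.imp :=
  le_ciSup (Set.finite_range a.impAt).bddAbove z

theorem exists_imp_eq (h : IsIntervalGraph G) : ∃ a : IntervalRep G, a.imp = imp G := by
  have : Nonempty (IntervalRep G) := h
  exact ciInf_mem (fun a : IntervalRep G => a.imp)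

theorem imp_le_of_embedding [Finite V'] (h : IsIntervalGraph G') (f : G ↪g G') :
    imp G ≤ imp G' := by
  obtain ⟨a, ha⟩ := exists_imp_eq h
  refine imp_le_of_impAt_le (a.comap f) fun z => ?_
  exact (a.impAt_comap_le f z).trans ((a.impAt_le_imp _).trans ha.le)

theorem imp_le_of_endpoints [Finite V] (S : Set V) (l r : V → ℝ) (hlr : ∀ v, l v ≤ r v)
    (h : ∀ v ∈ S, ∀ w ∈ S, v ≠ w → (G.Adj v w ↔ l v ≤ r w ∧ l w ≤ r v)) {p : ℕ}
    (hp : ∀ z ∈ S, {w | w ∈ S ∧ w ≠ z ∧ l z ≤ l w ∧ r w ≤ r z}.ncard ≤ p) :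
    imp (G.induce S) ≤ p := by
  let a : IntervalRep (G.induce S) := .ofEndpoints (fun v => l v) (fun v => r v)
    (fun v => hlr v) fun v w hvw => h v v.2 w w.2 (Subtype.coe_injective.ne hvw)
  refine imp_le_of_impAt_le a fun z => ?_
  rw [a.impAt_eq_ncard, ← Set.ncard_image_of_injective _ Subtype.coe_injective]
  refine (Set.ncard_le_ncard ?_ (Set.toFinite _)).trans (hp z z.2)
  rintro _ ⟨w, ⟨h1, h2, h3⟩, rfl⟩
  exact ⟨w.2, Subtype.coe_injective.ne h1, h2, h3⟩

/-- A pendant pair `x j — y j` at `z` occupies one of the two ends of the interval of `z`. What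
sticks out of the interval of `z` at an end that is not occupied is a clique. -/
theorem IntervalRep.exists_cliques [Finite V] (a : IntervalRep G) (z : V) (A : Set V)
    (hA : ∀ v ∈ A, G.Adj z v) {k : ℕ} (x y : Fin k → V) (hyx : ∀ j, G.Adj (y j) (x j))
    (hzy : ∀ j, G.Adj z (y j)) (hxz : ∀ j, x j ≠ z) (hx : ∀ j, ¬ G.Adj z (x j))
    (hyA : ∀ j, ∀ v ∈ A, v ≠ y j ∧ ¬ G.Adj v (y j))
    (hyy : ∀ i j, i ≠ j → y i ≠ y j ∧ ¬ G.Adj (y i) (y j)) :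
    k ≤ 2 ∧ ∃ Q R : Set V, Q ⊆ A ∧ R ⊆ A ∧ G.IsClique Q ∧ G.IsClique R ∧
      A.ncard ≤ a.impAt z + (Q ∪ R).ncard ∧ (1 ≤ k → Q = ∅) ∧ (2 ≤ k → R = ∅) := by
  have side : ∀ j, (a.l (y j) < a.l z ∧ a.l z ≤ a.r (y j)) ∨
      (a.l (y j) ≤ a.r z ∧ a.r z < a.r (y j)) := by
    intro j
    have h1 := (a.adj_iff_le (hxz j).symm).not.1 (hx j)
    have h2 := (a.adj_iff_le (hzy j).ne).1 (hzy j)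
    have h3 := (a.adj_iff_le (hyx j).ne).1 (hyx j)
    by_cases h : a.l z ≤ a.r (x j)
    · right
      exact ⟨h2.2, by by_contra! h'; exact h1 ⟨h, h3.2.trans h'⟩⟩
    · left
      exact ⟨by linarith [h3.1], h2.1⟩
  set L : Set V := {v | v ∈ A ∧ a.l v < a.l z} with hL
  set R : Set V := {v | v ∈ A ∧ a.r z < a.r v} with hR
  have hLc : G.IsClique L := by
    intro v hv w hw hvw
    have h1 := (a.adj_iff_le (hA v hv.1).ne).1 (hA v hv.1)
    have h2 := (a.adj_iff_le (hA w hw.1).ne).1 (hA w hw.1)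
    exact (a.adj_iff_le hvw).2 ⟨hv.2.le.trans h2.1, hw.2.le.trans h1.1⟩
  have hRc : G.IsClique R := by
    intro v hv w hw hvw
    have h1 := (a.adj_iff_le (hA v hv.1).ne).1 (hA v hv.1)
    have h2 := (a.adj_iff_le (hA w hw.1).ne).1 (hA w hw.1)
    exact (a.adj_iff_le hvw).2 ⟨h1.2.trans hw.2.le, h2.2.trans hv.2.le⟩
  have hcount : A.ncard ≤ a.impAt z + (L ∪ R).ncard := by
    rw [a.impAt_eq_ncard]
    refine (Set.ncard_le_ncard ?_ (Set.toFinite _)).trans (Set.ncard_union_le _ _)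
    intro v hv
    by_cases h1 : a.l v < a.l z
    · exact .inr (.inl ⟨hv, h1⟩)
    by_cases h2 : a.r z < a.r v
    · exact .inr (.inr ⟨hv, h2⟩)
    exact .inl ⟨(hA v hv).ne', not_lt.1 h1, not_lt.1 h2⟩
  have hL0 : ∀ j, (a.l (y j) < a.l z ∧ a.l z ≤ a.r (y j)) → L = ∅ := by
    intro j hj
    refine Set.eq_empty_of_forall_notMem fun v hv => ?_
    have h1 := (a.adj_iff_le (hA v hv.1).ne).1 (hA v hv.1)
    exact (hyA j v hv.1).2 ((a.adj_iff_le (hyA j v hv.1).1).2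
      ⟨hv.2.le.trans hj.2, hj.1.le.trans h1.1⟩)
  have hR0 : ∀ j, (a.l (y j) ≤ a.r z ∧ a.r z < a.r (y j)) → R = ∅ := by
    intro j hj
    refine Set.eq_empty_of_forall_notMem fun v hv => ?_
    have h1 := (a.adj_iff_le (hA v hv.1).ne).1 (hA v hv.1)
    exact (hyA j v hv.1).2 ((a.adj_iff_le (hyA j v hv.1).1).2
      ⟨h1.2.trans hj.2.le, hj.1.trans hv.2.le⟩)
  have hside : ∀ i j, i ≠ j → (a.l (y i) < a.l z ∧ a.l z ≤ a.r (y i)) →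
      (a.l (y j) < a.l z ∧ a.l z ≤ a.r (y j)) → False := fun i j hij hi hj =>
    (hyy i j hij).2 ((a.adj_iff_le (hyy i j hij).1).2
      ⟨hi.1.le.trans hj.2, hj.1.le.trans hi.2⟩)
  have hside' : ∀ i j, i ≠ j → (a.l (y i) ≤ a.r z ∧ a.r z < a.r (y i)) →
      (a.l (y j) ≤ a.r z ∧ a.r z < a.r (y j)) → False := fun i j hij hi hj =>
    (hyy i j hij).2 ((a.adj_iff_le (hyy i j hij).1).2
      ⟨hi.1.trans hj.2.le, hj.1.trans hi.2.le⟩)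
  constructor
  · by_contra! hk
    have h01 : (⟨0, by omega⟩ : Fin k) ≠ ⟨1, by omega⟩ := by simp
    have h02 : (⟨0, by omega⟩ : Fin k) ≠ ⟨2, by omega⟩ := by simp
    have h12 : (⟨1, by omega⟩ : Fin k) ≠ ⟨2, by omega⟩ := by simp
    have p01 := hside _ _ h01
    have p02 := hside _ _ h02
    have p12 := hside _ _ h12
    have q01 := hside' _ _ h01
    have q02 := hside' _ _ h02
    have q12 := hside' _ _ h12
    rcases side ⟨0, by omega⟩ with h0 | h0 <;> rcases side ⟨1, by omega⟩ with h1 | h1 <;>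
      rcases side ⟨2, by omega⟩ with h2 | h2 <;>
      first
      | exact p01 h0 h1
      | exact p02 h0 h2
      | exact p12 h1 h2
      | exact q01 h0 h1
      | exact q02 h0 h2
      | exact q12 h1 h2
  have hLA : L ⊆ A := fun v hv => hv.1
  have hRA : R ⊆ A := fun v hv => hv.1
  by_cases hk : 1 ≤ k
  · by_cases hk2 : 2 ≤ k
    · have h01 : (⟨0, by omega⟩ : Fin k) ≠ ⟨1, by omega⟩ := by simp
      have p01 := hside _ _ h01
      have q01 := hside' _ _ h01
      have : L = ∅ ∧ R = ∅ := by
        rcases side ⟨0, by omega⟩ with h0 | h0 <;> rcases side ⟨1, by omega⟩ with h1 | h1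
        · exact (p01 h0 h1).elim
        · exact ⟨hL0 _ h0, hR0 _ h1⟩
        · exact ⟨hL0 _ h1, hR0 _ h0⟩
        · exact (q01 h0 h1).elim
      exact ⟨L, R, hLA, hRA, hLc, hRc, hcount, fun _ => this.1, fun _ => this.2⟩
    · rcases side ⟨0, by omega⟩ with h0 | h0
      · exact ⟨L, R, hLA, hRA, hLc, hRc, hcount, fun _ => hL0 _ h0, fun h => (hk2 h).elim⟩
      · exact ⟨R, L, hRA, hLA, hRc, hLc, by rwa [Set.union_comm], fun _ => hR0 _ h0,
          fun h => (hk2 h).elim⟩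
  · exact ⟨L, R, hLA, hRA, hLc, hRc, hcount, fun h => (hk h).elim, fun h => by omega⟩

/-- The bound of `IntervalRep.exists_cliques` for the impropriety of an induced subgraph. -/
theorem exists_cliques_induce [Finite V] (hG : IsIntervalGraph G) (S : Set V) {z : V} (hz : z ∈ S)
    {A : Set V} (hAS : A ⊆ S) (hA : ∀ v ∈ A, G.Adj z v) {k : ℕ} {x y : Fin k → V}
    (hxS : ∀ j, x j ∈ S) (hyS : ∀ j, y j ∈ S) (hyx : ∀ j, G.Adj (y j) (x j))
    (hzy : ∀ j, G.Adj z (y j)) (hxz : ∀ j, x j ≠ z) (hx : ∀ j, ¬ G.Adj z (x j))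
    (hyA : ∀ j, ∀ v ∈ A, v ≠ y j ∧ ¬ G.Adj v (y j))
    (hyy : ∀ i j, i ≠ j → y i ≠ y j ∧ ¬ G.Adj (y i) (y j)) :
    k ≤ 2 ∧ ∃ Q R : Set V, Q ⊆ A ∧ R ⊆ A ∧ G.IsClique Q ∧ G.IsClique R ∧
      A.ncard ≤ imp (G.induce S) + (Q ∪ R).ncard ∧ (1 ≤ k → Q = ∅) ∧ (2 ≤ k → R = ∅) := by
  obtain ⟨a, ha⟩ := exists_imp_eq (hG.of_embedding (SimpleGraph.Embedding.induce S))
  have hinj : Function.Injective ((↑) : S → V) := Subtype.coe_injective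
  obtain ⟨hk, Q, R, hQ, hR, hQc, hRc, hcard, h1, h2⟩ :=
    a.exists_cliques ⟨z, hz⟩ (((↑) : S → V) ⁻¹' A) (fun v hv => hA v hv) (fun j => ⟨x j, hxS j⟩)
      (fun j => ⟨y j, hyS j⟩) hyx hzy (fun j h => hxz j (congrArg Subtype.val h)) hx
      (fun j v hv => ⟨fun h => (hyA j v hv).1 (congrArg Subtype.val h), (hyA j v hv).2⟩)
      (fun i j hij => ⟨fun h => (hyy i j hij).1 (congrArg Subtype.val h), (hyy i j hij).2⟩)
  have himg : ((↑) : S → V) '' ((↑) ⁻¹' A) = A := by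
    rw [Set.image_preimage_eq_iff]
    simpa using hAS
  have hclique : ∀ Q : Set S, (G.induce S).IsClique Q → G.IsClique ((↑) '' Q : Set V) := by
    rintro Q hQ _ ⟨v, hv, rfl⟩ _ ⟨w, hw, rfl⟩ hvw
    exact hQ hv hw fun h => hvw (congrArg _ h)
  refine ⟨hk, (↑) '' Q, (↑) '' R, ?_, ?_, hclique Q hQc, hclique R hRc, ?_,
    fun h => by simp [h1 h], fun h => by simp [h2 h]⟩
  · rintro _ ⟨v, hv, rfl⟩
    exact hQ hv
  · rintro _ ⟨v, hv, rfl⟩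
    exact hR hv
  · rw [← Set.image_union, Set.ncard_image_of_injective _ hinj]
    rw [← Set.ncard_image_of_injective _ hinj, himg] at hcard
    have := a.impAt_le_imp ⟨z, hz⟩
    omega

end Basic

section SmallestSum

theorem sum_take_le_of_sublist {l' l : List ℕ} (h : l'.Sublist l) :
    ∀ {t : ℕ}, l.Pairwise (· ≤ ·) → t ≤ l'.length → (l.take t).sum ≤ l'.sum := by
  induction h with
  | slnil => simp
  | @cons l₁ l₂ a h ih =>
    intro t hl ht
    rw [List.pairwise_cons] at hl
    refine le_trans ?_ (ih hl.2 ht)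
    cases t with
    | zero => simp
    | succ t =>
      have hlt : t < l₂.length := lt_of_lt_of_le ht h.length_le
      have := hl.1 l₂[t] (List.getElem_mem hlt)
      rw [List.take_succ_cons, List.sum_cons, List.sum_take_succ _ _ hlt]
      omega
  | @cons_cons l₁ l₂ a h ih =>
    intro t hl ht
    rw [List.pairwise_cons] at hl
    cases t with
    | zero => simp
    | succ t =>
      have := ih hl.2 (t := t) (by simpa using ht)
      simpa using this

theorem sum_take_sort_le {s t : Multiset ℕ} (h : t ≤ s) {n : ℕ} (hn : n ≤ t.card) :
    ((s.sort (· ≤ ·)).take n).sum ≤ t.sum := by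
  have hsub : (t.sort (· ≤ ·)).Sublist (s.sort (· ≤ ·)) := by
    refine List.sublist_of_subperm_of_pairwise ?_ (t.pairwise_sort _) (s.pairwise_sort _)
    rwa [← Multiset.coe_le, Multiset.sort_eq, Multiset.sort_eq]
  have := sum_take_le_of_sublist hsub (s.pairwise_sort _) (t := n) (by simpa using hn)
  rwa [← Multiset.sum_coe (t.sort _), Multiset.sort_eq] at this

theorem sum_le_sum_take_sort_add {s : Multiset ℕ} {m : ℕ} (h : ∀ a ∈ s, a ≤ m) (n : ℕ) :
    s.sum ≤ ((s.sort (· ≤ ·)).take n).sum + (s.card - n) * m := by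
  have h1 : ((s.sort (· ≤ ·)).drop n).sum ≤ (s.card - n) * m := by
    have := List.sum_le_card_nsmul ((s.sort (· ≤ ·)).drop n) m fun a ha =>
      h a ((Multiset.mem_sort _).1 (List.mem_of_mem_drop ha))
    simpa using this
  calc s.sum = (s.sort (· ≤ ·)).sum := by rw [← Multiset.sum_coe, Multiset.sort_eq]
    _ = ((s.sort (· ≤ ·)).take n).sum + ((s.sort (· ≤ ·)).drop n).sum :=
      (List.sum_take_add_sum_drop _ _).symm
    _ ≤ _ := by omega

end SmallestSum

section Weight

variable {V : Type u} {G : SimpleGraph V} {z : V}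

/-- The vertices of a local component. -/
def LocalComponent.verts (C : LocalComponent G z) : Set V := Subtype.val '' C.supp

theorem LocalComponent.ncard_verts (C : LocalComponent G z) : C.verts.ncard = C.order := by
  rw [LocalComponent.verts, Set.ncard_image_of_injective _ Subtype.coe_injective]
  rfl

/-- The local component of a vertex. -/
def localComponentOf (G : SimpleGraph V) {z v : V} (h : v ≠ z) : LocalComponent G z :=
  (G.induce ({z}ᶜ : Set V)).connectedComponentMk ⟨v, h⟩

theorem mem_verts_iff {C : LocalComponent G z} {v : V} :
    v ∈ C.verts ↔ ∃ h : v ≠ z, localComponentOf G h = C := by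
  constructor
  · rintro ⟨⟨w, hw⟩, h, rfl⟩
    exact ⟨hw, h⟩
  · rintro ⟨h, rfl⟩
    exact ⟨⟨v, h⟩, rfl, rfl⟩

end Weight
section Weight

variable {V : Type u} {G : SimpleGraph V} {z : V}

theorem localComponentOf_eq_of_adj {v w : V} (hv : v ≠ z) (hw : w ≠ z) (h : G.Adj v w) :
    localComponentOf G hv = localComponentOf G hw :=
  SimpleGraph.ConnectedComponent.connectedComponentMk_eq_of_adj h

theorem mem_verts_of_adj {C : LocalComponent G z} {v w : V} (hv : v ∈ C.verts) (hw : w ≠ z)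
    (h : G.Adj v w) : w ∈ C.verts := by
  obtain ⟨hvz, rfl⟩ := mem_verts_iff.1 hv
  exact mem_verts_iff.2 ⟨hw, (localComponentOf_eq_of_adj hvz hw h).symm⟩

theorem ne_of_mem_verts {C : LocalComponent G z} {v : V} (hv : v ∈ C.verts) : v ≠ z :=
  (mem_verts_iff.1 hv).1

theorem eq_of_mem_verts {C D : LocalComponent G z} {v : V} (hC : v ∈ C.verts)
    (hD : v ∈ D.verts) : C = D := by
  obtain ⟨h, rfl⟩ := mem_verts_iff.1 hC
  exact (mem_verts_iff.1 hD).2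

theorem LocalComponent.verts_nonempty (C : LocalComponent G z) : C.verts.Nonempty :=
  C.nonempty_supp.image _

theorem LocalComponent.order_pos [Finite V] (C : LocalComponent G z) : 0 < C.order := by
  rw [← C.ncard_verts]
  exact C.verts_nonempty.ncard_pos

theorem LocalComponent.isExterior_iff (C : LocalComponent G z) :
    C.IsExterior ↔ ∃ v ∈ C.verts, ¬ G.Adj z v := by
  constructor
  · rintro ⟨v, hv, h⟩
    exact ⟨v, ⟨v, hv, rfl⟩, h⟩
  · rintro ⟨_, ⟨v, hv, rfl⟩, h⟩
    exact ⟨v, hv, h⟩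

theorem ncard_biUnion_verts [Finite V] (T : Finset (LocalComponent G z)) :
    (⋃ C ∈ T, C.verts).ncard = ∑ C ∈ T, C.order := by
  classical
  induction T using Finset.induction_on with
  | empty => simp
  | insert C T hC ih =>
    rw [Finset.set_biUnion_insert, Finset.sum_insert hC, Set.ncard_union_eq ?_ (Set.toFinite _)
      (Set.toFinite _), ih, C.ncard_verts]
    rw [Set.disjoint_left]
    intro v hv hv'
    simp only [Set.mem_iUnion] at hv'
    obtain ⟨D, hD, hvD⟩ := hv'
    exact hC (eq_of_mem_verts hv hvD ▸ hD)

/-- A clique that avoids `z` is contained in a local component. -/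
theorem exists_subset_verts {Q : Set V} (hQ : G.IsClique Q) (hz : z ∉ Q) (hne : Q.Nonempty) :
    ∃ C : LocalComponent G z, Q ⊆ C.verts := by
  obtain ⟨v, hv⟩ := hne
  have hvz : v ≠ z := fun h => hz (h ▸ hv)
  refine ⟨localComponentOf G hvz, fun w hw => ?_⟩
  by_cases h : v = w
  · exact mem_verts_iff.2 ⟨h ▸ hvz, by subst h; rfl⟩
  · exact mem_verts_of_adj (mem_verts_iff.2 ⟨hvz, rfl⟩) (fun h => hz (h ▸ hw)) (hQ hv hw h)

/-- The vertices of the non-exterior local components. -/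
def innerVerts (G : SimpleGraph V) (z : V) : Set V :=
  {v | ∃ C : LocalComponent G z, ¬ C.IsExterior ∧ v ∈ C.verts}

theorem adj_of_mem_innerVerts {v : V} (hv : v ∈ innerVerts G z) : G.Adj z v := by
  obtain ⟨C, hC, hv⟩ := hv
  rw [C.isExterior_iff] at hC
  push Not at hC
  exact hC v hv

theorem LocalComponent.IsExterior.exists_pair (hG : G.Connected) {C : LocalComponent G z}
    (hC : C.IsExterior) :
    ∃ x y, x ∈ C.verts ∧ y ∈ C.verts ∧ G.Adj y x ∧ G.Adj z y ∧ ¬ G.Adj z x := by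
  obtain ⟨v, hv, hvz⟩ := hC
  have hva : v.1 ∈ C.verts := ⟨v, hv, rfl⟩
  obtain ⟨p⟩ := hG.preconnected v.1 z
  obtain ⟨d, -, hd1, hd2⟩ := p.exists_boundary_dart C.verts hva
    (fun h => ne_of_mem_verts h rfl)
  have hdz : d.snd = z := by
    by_contra h
    exact hd2 (mem_verts_of_adj hd1 h d.adj)
  obtain ⟨w, hw, hwd⟩ := hd1
  have hwz : G.Adj z w := by
    have := d.adj
    rw [hdz, ← hwd] at this
    exact this.symm
  have hreach : (G.induce ({z}ᶜ : Set V)).Reachable v w :=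
    SimpleGraph.ConnectedComponent.eq.1 (hv.trans hw.symm)
  obtain ⟨q⟩ := hreach
  obtain ⟨e, -, he1, he2⟩ := q.exists_boundary_dart {u | u ∈ C.supp ∧ ¬ G.Adj z u} ⟨hv, hvz⟩
    (fun h => h.2 hwz)
  have hmem : e.snd ∈ C.supp :=
    (SimpleGraph.ConnectedComponent.connectedComponentMk_eq_of_adj e.adj).symm.trans he1.1
  refine ⟨e.fst, e.snd, ⟨_, he1.1, rfl⟩, ⟨_, hmem, rfl⟩, e.adj.symm, ?_, he1.2⟩
  by_contra h
  exact he2 ⟨hmem, h⟩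

/-- A choice of a pendant pair in every exterior local component. -/
structure PendantPairs (G : SimpleGraph V) (z : V) (k : ℕ) where
  comp : Fin k ≃ {C : LocalComponent G z // C.IsExterior}
  x : Fin k → V
  y : Fin k → V
  x_mem : ∀ j, x j ∈ (comp j).1.verts
  y_mem : ∀ j, y j ∈ (comp j).1.verts
  adj : ∀ j, G.Adj (y j) (x j)
  adj_z : ∀ j, G.Adj z (y j)
  not_adj_z : ∀ j, ¬ G.Adj z (x j)

namespace PendantPairs

variable {k : ℕ} (P : PendantPairs G z k)

theorem card_exterior (P : PendantPairs G z k) :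
    Nat.card {C : LocalComponent G z // C.IsExterior} = k := by
  rw [← Nat.card_congr P.comp, Nat.card_fin]

theorem x_ne (j : Fin k) : P.x j ≠ z := ne_of_mem_verts (P.x_mem j)

theorem y_ne (j : Fin k) : P.y j ≠ z := ne_of_mem_verts (P.y_mem j)

theorem comp_ne {i j : Fin k} (h : i ≠ j) : (P.comp i).1 ≠ (P.comp j).1 := fun h' =>
  h (P.comp.injective (Subtype.ext h'))

theorem not_adj_of_mem {C : LocalComponent G z} {v : V} (hv : v ∈ C.verts) {j : Fin k} {w : V}
    (hw : w ∈ (P.comp j).1.verts) (h : (P.comp j).1 ≠ C) : v ≠ w ∧ ¬ G.Adj v w := by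
  refine ⟨?_, fun hvw => ?_⟩
  · rintro rfl
    exact h (eq_of_mem_verts hw hv)
  · exact h (eq_of_mem_verts hw (mem_verts_of_adj hv (ne_of_mem_verts hw) hvw))

theorem not_adj_inner {v : V} (hv : v ∈ innerVerts G z) {j : Fin k} {w : V}
    (hw : w ∈ (P.comp j).1.verts) : v ≠ w ∧ ¬ G.Adj v w := by
  obtain ⟨C, hC, hv⟩ := hv
  exact P.not_adj_of_mem hv hw fun h => hC (h ▸ (P.comp j).2)

end PendantPairs

variable [Finite V]

/-- The set of the non-exterior local components. -/
noncomputable def nonExterior (G : SimpleGraph V) (z : V) : Finset (LocalComponent G z) :=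
  (Set.toFinite {C : LocalComponent G z | ¬ C.IsExterior}).toFinset

theorem mem_nonExterior {C : LocalComponent G z} : C ∈ nonExterior G z ↔ ¬ C.IsExterior := by
  simp [nonExterior]

theorem innerVerts_eq : innerVerts G z = ⋃ C ∈ nonExterior G z, C.verts := by
  ext v
  simp [innerVerts, mem_nonExterior]

theorem ncard_innerVerts : (innerVerts G z).ncard = ∑ C ∈ nonExterior G z, C.order := by
  rw [innerVerts_eq, ncard_biUnion_verts]

theorem card_localComponent : Nat.card (LocalComponent G z) =
    (nonExterior G z).card + Nat.card {C : LocalComponent G z // C.IsExterior} := by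
  classical
  have := Fintype.ofFinite (LocalComponent G z)
  rw [Nat.card_eq_fintype_card, Nat.card_eq_fintype_card, Fintype.card_subtype,
    ← Finset.card_univ,
    ← Finset.card_filter_add_card_filter_not (fun C : LocalComponent G z => ¬ C.IsExterior)]
  congr 2
  · ext C
    simp [mem_nonExterior]
  · simp

theorem wtAt_le_sum {T : Finset (LocalComponent G z)} (hT : T ⊆ nonExterior G z)
    (hcard : Nat.card (LocalComponent G z) - 2 ≤ T.card) : wtAt G z ≤ ∑ C ∈ T, C.order := by
  have h : T.val.map LocalComponent.order ≤ nonExteriorOrders G z :=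
    Multiset.map_le_map (Finset.val_le_iff.2 hT)
  exact sum_take_sort_le h (by simpa using hcard)

theorem wtAt_add_sum_le {D : Finset (LocalComponent G z)} (hD : D ⊆ nonExterior G z)
    (hcard : D.card + Nat.card {C : LocalComponent G z // C.IsExterior} ≤ 2) :
    wtAt G z + ∑ C ∈ D, C.order ≤ (innerVerts G z).ncard := by
  classical
  rw [ncard_innerVerts, ← Finset.sum_sdiff hD]
  refine Nat.add_le_add_right (wtAt_le_sum Finset.sdiff_subset ?_) _
  have := Finset.card_sdiff_add_card_eq_card hD
  have := card_localComponent (G := G) (z := z)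
  omega

theorem ncard_innerVerts_le {m : ℕ} (hm : ∀ C ∈ nonExterior G z, C.order ≤ m) :
    (innerVerts G z).ncard ≤ wtAt G z +
      (2 - Nat.card {C : LocalComponent G z // C.IsExterior}) * m := by
  have h := sum_le_sum_take_sort_add (s := nonExteriorOrders G z) (m := m) (by
    intro a ha
    obtain ⟨C, hC, rfl⟩ := Multiset.mem_map.1 ha
    exact hm C hC) (Nat.card (LocalComponent G z) - 2)
  rw [ncard_innerVerts]
  refine h.trans (Nat.add_le_add_left (Nat.mul_le_mul_right _ ?_) _)
  have h1 : (nonExteriorOrders G z).card = (nonExterior G z).card := by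
    rw [nonExteriorOrders, Multiset.card_map]
    rfl
  have := card_localComponent (G := G) (z := z)
  omega

theorem exists_pendantPairs (hG : G.Connected) (z : V) :
    Nonempty (PendantPairs G z (Nat.card {C : LocalComponent G z // C.IsExterior})) := by
  choose x y h using fun C : {C : LocalComponent G z // C.IsExterior} => C.2.exists_pair hG
  let e := (Finite.equivFin {C : LocalComponent G z // C.IsExterior}).symm
  exact ⟨⟨e, fun j => x (e j), fun j => y (e j), fun j => (h (e j)).1, fun j => (h (e j)).2.1,
    fun j => (h (e j)).2.2.1, fun j => (h (e j)).2.2.2.1, fun j => (h (e j)).2.2.2.2⟩⟩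

namespace PendantPairs

variable {k : ℕ}

theorem exists_cliques (P : PendantPairs G z k) (hI : IsIntervalGraph G) {S A : Set V}
    (hz : z ∈ S) (hAS : A ⊆ S) (hA : A ⊆ innerVerts G z) (hx : ∀ j, P.x j ∈ S)
    (hy : ∀ j, P.y j ∈ S) :
    k ≤ 2 ∧ ∃ Q R : Set V, Q ⊆ A ∧ R ⊆ A ∧ G.IsClique Q ∧ G.IsClique R ∧
      A.ncard ≤ imp (G.induce S) + (Q ∪ R).ncard ∧ (1 ≤ k → Q = ∅) ∧ (2 ≤ k → R = ∅) :=
  exists_cliques_induce hI S hz hAS (fun _ hv => adj_of_mem_innerVerts (hA hv)) hx hy P.adj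
    P.adj_z P.x_ne P.not_adj_z (fun j _ hv => P.not_adj_inner (hA hv) (P.y_mem j))
    fun _ j hij => P.not_adj_of_mem (P.y_mem _) (P.y_mem j) (P.comp_ne hij.symm)

theorem card_le_two (P : PendantPairs G z k) (hI : IsIntervalGraph G) : k ≤ 2 :=
  (P.exists_cliques hI (S := Set.univ) (A := ∅) trivial (by simp) (by simp) (by simp)
    (by simp)).1

end PendantPairs

theorem exists_mem_nonExterior {Q : Set V} (hQ : G.IsClique Q) (hQz : Q ⊆ innerVerts G z)
    (hne : Q.Nonempty) : ∃ C ∈ nonExterior G z, Q ⊆ C.verts := by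
  obtain ⟨C, hC⟩ := exists_subset_verts hQ
    (fun h => (adj_of_mem_innerVerts (hQz h)).ne rfl) hne
  obtain ⟨v, hv⟩ := hne
  obtain ⟨C', hC', hv'⟩ := hQz hv
  exact ⟨C, mem_nonExterior.2 (eq_of_mem_verts (hC hv) hv' ▸ hC'), hC⟩

theorem exists_cover {Q : Set V} (hQ : G.IsClique Q) (hQz : Q ⊆ innerVerts G z) :
    ∃ D ⊆ nonExterior G z, D.card ≤ 1 ∧ (Q = ∅ → D = ∅) ∧ Q ⊆ ⋃ C ∈ D, C.verts := by
  rcases Q.eq_empty_or_nonempty with rfl | hne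
  · exact ⟨∅, by simp, by simp, by simp, by simp⟩
  obtain ⟨C, hC, hQC⟩ := exists_mem_nonExterior hQ hQz hne
  exact ⟨{C}, by simpa, by simp, fun h => (hne.ne_empty h).elim, by simpa⟩

theorem PendantPairs.wtAt_le_imp_induce {k : ℕ} (P : PendantPairs G z k)
    (hI : IsIntervalGraph G) {S : Set V} (hz : z ∈ S) (hA : innerVerts G z ⊆ S)
    (hx : ∀ j, P.x j ∈ S) (hy : ∀ j, P.y j ∈ S) : wtAt G z ≤ imp (G.induce S) := by
  classical
  obtain ⟨hk, Q, R, hQ, hR, hQc, hRc, hcard, h1, h2⟩ := P.exists_cliques hI hz hA subset_rfl hx hy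
  obtain ⟨D, hD, hD1, hD0, hQD⟩ := exists_cover hQc hQ
  obtain ⟨E, hE, hE1, hE0, hRE⟩ := exists_cover hRc hR
  have hcardDE : (D ∪ E).card + k ≤ 2 := by
    have := Finset.card_union_le D E
    by_cases hk1 : 1 ≤ k
    · rw [hD0 (h1 hk1), Finset.empty_union] at this ⊢
      by_cases hk2 : 2 ≤ k
      · rw [hE0 (h2 hk2), Finset.card_empty]
        omega
      · omega
    · omega
  have hw := wtAt_add_sum_le (Finset.union_subset hD hE) (by rwa [P.card_exterior])
  have hsub : Q ∪ R ⊆ ⋃ C ∈ D ∪ E, C.verts := by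
    rw [Finset.set_biUnion_union]
    exact Set.union_subset_union hQD hRE
  have := Set.ncard_le_ncard hsub (Set.toFinite _)
  rw [ncard_biUnion_verts] at this
  omega

theorem wt_le_imp (hG : G.Connected) (hI : IsIntervalGraph G) : wt G ≤ imp G := by
  refine ciSup_le' fun z => ?_
  obtain ⟨P⟩ := exists_pendantPairs hG z
  exact (P.wtAt_le_imp_induce hI (S := Set.univ) trivial (by simp) (by simp) (by simp)).trans
    (imp_le_of_embedding hI (SimpleGraph.Embedding.induce _))

theorem wtAt_le_wt (G : SimpleGraph V) (z : V) : wtAt G z ≤ wt G :=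
  le_ciSup (f := wtAt G) (Set.finite_range _).bddAbove z

/-- A lower bound for the weight of `z` from a labelling of the other vertices that is constant on
the local components: the labels in `ι` belong to neighbours of `z` only, the labels in `Fin k`
belong to exterior local components. -/
theorem ncard_le_wtAt_add {ι : Type*} {k m : ℕ} (c : V → ι ⊕ Fin k)
    (hc : ∀ v w, v ≠ z → w ≠ z → G.Adj v w → c v = c w)
    (hadj : ∀ v i, v ≠ z → c v = .inl i → G.Adj z v)
    (hm : ∀ i, {v | v ≠ z ∧ c v = .inl i}.ncard ≤ m)
    (hext : ∀ j, ∃ v, v ≠ z ∧ c v = .inr j ∧ ¬ G.Adj z v ∧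
      ∀ w, w ≠ z → c w = .inr j → w = v ∨ G.Adj w v) :
    {v | v ≠ z ∧ ∃ i, c v = .inl i}.ncard ≤ wtAt G z + (2 - k) * m := by
  have hcomp : ∀ (C : LocalComponent G z) v w, v ∈ C.verts → w ∈ C.verts → c v = c w := by
    rintro C _ _ ⟨v, hv, rfl⟩ ⟨w, hw, rfl⟩
    obtain ⟨p⟩ : (G.induce ({z}ᶜ : Set V)).Reachable v w :=
      SimpleGraph.ConnectedComponent.eq.1 (hv.trans hw.symm)
    induction p with
    | nil => rfl
    | @cons u v w h p ih =>
      refine (hc u v u.2 v.2 h).trans (ih ?_ hw)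
      exact (SimpleGraph.ConnectedComponent.connectedComponentMk_eq_of_adj h).symm.trans hv
  have hinl : ∀ (C : LocalComponent G z) v i, v ∈ C.verts → c v = .inl i → ¬ C.IsExterior := by
    intro C v i hv hi
    rw [C.isExterior_iff]
    rintro ⟨w, hw, hwz⟩
    exact hwz (hadj w i (ne_of_mem_verts hw) ((hcomp C w v hw hv).trans hi))
  have hk : k ≤ Nat.card {C : LocalComponent G z // C.IsExterior} := by
    choose f hf1 hf2 hf3 _ using hext
    have hmem : ∀ j, f j ∈ (localComponentOf G (hf1 j)).verts :=
      fun j => mem_verts_iff.2 ⟨hf1 j, rfl⟩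
    let g : Fin k → {C : LocalComponent G z // C.IsExterior} := fun j =>
      ⟨localComponentOf G (hf1 j), (LocalComponent.isExterior_iff _).2 ⟨f j, hmem j, hf3 j⟩⟩
    have hg : Function.Injective g := by
      intro i j hij
      have h : localComponentOf G (hf1 i) = localComponentOf G (hf1 j) :=
        congrArg Subtype.val hij
      have := hcomp _ _ _ (hmem i) (h ▸ hmem j)
      rw [hf2, hf2] at this
      exact Sum.inr_injective this
    simpa using Nat.card_le_card_of_injective g hg
  have hsub : {v | v ≠ z ∧ ∃ i, c v = .inl i} ⊆ innerVerts G z := by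
    rintro v ⟨hv, i, hi⟩
    have hmem : v ∈ (localComponentOf G hv).verts := mem_verts_iff.2 ⟨hv, rfl⟩
    exact ⟨_, hinl _ v i hmem hi, hmem⟩
  have hord : ∀ C ∈ nonExterior G z, C.order ≤ m := by
    intro C hC
    rw [mem_nonExterior, C.isExterior_iff] at hC
    push Not at hC
    obtain ⟨v, hv⟩ := C.verts_nonempty
    rw [← C.ncard_verts]
    rcases hi : c v with i | j
    · refine (Set.ncard_le_ncard ?_ (Set.toFinite _)).trans (hm i)
      exact fun w hw => ⟨ne_of_mem_verts hw, (hcomp C w v hw hv).trans hi⟩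
    · obtain ⟨x, hxz, -, hx, h⟩ := hext j
      refine (hx (hC x ?_)).elim
      rcases h v (ne_of_mem_verts hv) hi with rfl | h
      · exact hv
      · exact mem_verts_of_adj hv hxz h
  refine (Set.ncard_le_ncard hsub (Set.toFinite _)).trans ((ncard_innerVerts_le hord).trans ?_)
  exact Nat.add_le_add_left (Nat.mul_le_mul_right _ (by omega)) _

end Weight
section Critical

variable {V : Type u} [Finite V] {G : SimpleGraph V} {z : V}

theorem IsCritical.connected {p : ℕ} (h : IsCritical G p) : G.Connected := by
  obtain ⟨hp, hI, himp, hS⟩ := h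
  have hne : Nonempty V := by
    by_contra hV
    rw [not_nonempty_iff] at hV
    obtain ⟨a⟩ := hI
    have := imp_le_of_impAt_le a (p := 0) fun z => isEmptyElim z
    omega
  refine ⟨?_⟩
  by_contra hG
  unfold SimpleGraph.Preconnected at hG
  push Not at hG
  obtain ⟨u, u', huu'⟩ := hG
  set S : Set V := {w | G.Reachable u w} with hSdef
  have hSu : u ∈ S := SimpleGraph.Reachable.refl u
  have hno : ∀ v ∈ S, ∀ w ∉ S, ¬ G.Adj v w := fun v hv w hw hvw =>
    hw (SimpleGraph.Reachable.trans hv hvw.reachable)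
  have h1 := hS S fun h => huu' (h ▸ Set.mem_univ u' : u' ∈ S)
  have h2 := hS Sᶜ fun h => (h ▸ Set.mem_univ u : u ∈ Sᶜ) hSu
  obtain ⟨a, ha⟩ := exists_imp_eq (hI.of_embedding (SimpleGraph.Embedding.induce S))
  obtain ⟨b, hb⟩ := exists_imp_eq (hI.of_embedding (SimpleGraph.Embedding.induce Sᶜ))
  classical
  let l : V → ℝ := fun v => if hv : v ∈ S then Real.arctan (a.l ⟨v, hv⟩)
    else Real.arctan (b.l ⟨v, hv⟩) + 4
  let r : V → ℝ := fun v => if hv : v ∈ S then Real.arctan (a.r ⟨v, hv⟩)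
    else Real.arctan (b.r ⟨v, hv⟩) + 4
  have hl1 : ∀ v (hv : v ∈ S), l v = Real.arctan (a.l ⟨v, hv⟩) := fun v hv => dif_pos hv
  have hr1 : ∀ v (hv : v ∈ S), r v = Real.arctan (a.r ⟨v, hv⟩) := fun v hv => dif_pos hv
  have hl2 : ∀ v (hv : v ∉ S), l v = Real.arctan (b.l ⟨v, hv⟩) + 4 := fun v hv => dif_neg hv
  have hr2 : ∀ v (hv : v ∉ S), r v = Real.arctan (b.r ⟨v, hv⟩) + 4 := fun v hv => dif_neg hv
  have hlo : ∀ t, -2 < Real.arctan t := fun t => by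
    linarith [Real.neg_pi_div_two_lt_arctan t, Real.pi_le_four]
  have hhi : ∀ t, Real.arctan t < 2 := fun t => by
    linarith [Real.arctan_lt_pi_div_two t, Real.pi_le_four]
  have hle : ∀ {s t : ℝ}, Real.arctan s ≤ Real.arctan t ↔ s ≤ t := Real.arctan_le_arctan_iff
  have key : imp (G.induce Set.univ) ≤ p - 1 := by
    refine imp_le_of_endpoints Set.univ l r ?_ ?_ ?_
    · intro v
      by_cases hv : v ∈ S
      · rw [hl1 v hv, hr1 v hv, hle]
        exact a.l_le_r _
      · rw [hl2 v hv, hr2 v hv, add_le_add_iff_right, hle]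
        exact b.l_le_r _
    · intro v _ w _ hvw
      by_cases hv : v ∈ S <;> by_cases hw : w ∈ S
      · rw [hl1 v hv, hr1 v hv, hl1 w hw, hr1 w hw, hle, hle]
        exact a.adj_iff_le (v := ⟨v, hv⟩) (w := ⟨w, hw⟩) fun h => hvw (congrArg Subtype.val h)
      · rw [hl1 v hv, hr1 v hv, hl2 w hw, hr2 w hw]
        refine iff_of_false (hno v hv w hw) fun h => ?_
        linarith [h.2, hlo (b.l ⟨w, hw⟩), hhi (a.r ⟨v, hv⟩)]
      · rw [hl2 v hv, hr2 v hv, hl1 w hw, hr1 w hw]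
        refine iff_of_false (fun h => hno w hw v hv h.symm) fun h => ?_
        linarith [h.1, hlo (b.l ⟨v, hv⟩), hhi (a.r ⟨w, hw⟩)]
      · rw [hl2 v hv, hr2 v hv, hl2 w hw, hr2 w hw, add_le_add_iff_right, hle,
          add_le_add_iff_right, hle]
        exact b.adj_iff_le (v := ⟨v, hv⟩) (w := ⟨w, hw⟩) fun h => hvw (congrArg Subtype.val h)
    · intro v _
      by_cases hv : v ∈ S
      · have hav := a.impAt_le_imp ⟨v, hv⟩
        rw [a.impAt_eq_ncard, ← Set.ncard_image_of_injective _ Subtype.coe_injective] at hav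
        refine (Set.ncard_le_ncard ?_ (Set.toFinite _)).trans (hav.trans (by omega))
        rintro w ⟨-, hwv, h3, h4⟩
        have hw : w ∈ S := by
          by_contra hw
          rw [hr1 v hv, hr2 w hw] at h4
          linarith [hlo (b.r ⟨w, hw⟩), hhi (a.r ⟨v, hv⟩)]
        rw [hl1 v hv, hl1 w hw, hle] at h3
        rw [hr1 v hv, hr1 w hw, hle] at h4
        exact ⟨⟨w, hw⟩, ⟨fun h => hwv (congrArg Subtype.val h), h3, h4⟩, rfl⟩
      · have hbv := b.impAt_le_imp ⟨v, hv⟩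
        rw [b.impAt_eq_ncard, ← Set.ncard_image_of_injective _ Subtype.coe_injective] at hbv
        refine (Set.ncard_le_ncard ?_ (Set.toFinite _)).trans (hbv.trans (by omega))
        rintro w ⟨-, hwv, h3, h4⟩
        have hw : w ∉ S := by
          intro hw
          rw [hl2 v hv, hl1 w hw] at h3
          linarith [hlo (b.l ⟨v, hv⟩), hhi (a.l ⟨w, hw⟩)]
        rw [hl2 v hv, hl2 w hw, add_le_add_iff_right, hle] at h3
        rw [hr2 v hv, hr2 w hw, add_le_add_iff_right, hle] at h4
        exact ⟨⟨w, hw⟩, ⟨fun h => hwv (congrArg Subtype.val h), h3, h4⟩, rfl⟩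
  have h3 := imp_le_of_embedding (hI.of_embedding (SimpleGraph.Embedding.induce Set.univ))
    (SimpleGraph.induceUnivIso G).symm.toEmbedding
  omega

namespace PendantPairs

/-- If no proper induced subgraph has impropriety at least the weight of `z`, then the exterior
local components at `z` consist of a pendant pair each. -/
theorem eq_or_mem {k : ℕ} (P : PendantPairs G z k) (hI : IsIntervalGraph G)
    (hcrit : ∀ S : Set V, S ≠ Set.univ → imp (G.induce S) < wtAt G z) (v : V) :
    v = z ∨ v ∈ innerVerts G z ∨ ∃ j, v = P.x j ∨ v = P.y j := by
  by_contra hv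
  set S : Set V := {v | v = z ∨ v ∈ innerVerts G z ∨ ∃ j, v = P.x j ∨ v = P.y j} with hS
  have h1 := hcrit S fun h => hv (h ▸ Set.mem_univ v : v ∈ S)
  have h2 := P.wtAt_le_imp_induce hI (S := S) (.inl rfl) (fun v hv => .inr (.inl hv))
    (fun j => .inr (.inr ⟨j, .inl rfl⟩)) (fun j => .inr (.inr ⟨j, .inr rfl⟩))
  omega

theorem exists_two_le_order {k : ℕ} (P : PendantPairs G z (k + 1)) (hI : IsIntervalGraph G)
    (hcrit : ∀ S : Set V, S ≠ Set.univ → imp (G.induce S) < wtAt G z) :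
    ∃ C ∈ nonExterior G z, 2 ≤ C.order := by
  by_contra! hC
  have hk := P.card_le_two hI
  set A : Set V := insert (P.y 0) (innerVerts G z) with hA
  have hAz : ∀ v ∈ A, G.Adj z v := by
    rintro v (rfl | hv)
    · exact P.adj_z 0
    · exact adj_of_mem_innerVerts hv
  have hxA : P.x 0 ∉ A := fun h => P.not_adj_z 0 (hAz _ h)
  have hyA : P.y 0 ∉ innerVerts G z := fun h => (P.not_adj_inner h (P.y_mem 0)).1 rfl
  have hne : ∀ j : Fin k, (P.comp j.succ).1 ≠ (P.comp 0).1 := fun j =>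
    P.comp_ne (Fin.succ_ne_zero j)
  obtain ⟨-, Q, R, hQ, hR, hQc, hRc, hcard, h1, h2⟩ := exists_cliques_induce hI {P.x 0}ᶜ
    (z := z) (A := A) (fun h => P.x_ne 0 h.symm) (fun v hv h => hxA (h ▸ hv)) hAz
    (x := fun j : Fin k => P.x j.succ) (y := fun j : Fin k => P.y j.succ)
    (fun j h => hne j (eq_of_mem_verts (P.x_mem _) (h ▸ P.x_mem 0)))
    (fun j h => hne j (eq_of_mem_verts (P.y_mem _) (h ▸ P.x_mem 0)))
    (fun j => P.adj _) (fun j => P.adj_z _) (fun j => P.x_ne _) (fun j => P.not_adj_z _)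
    (by
      rintro j v (rfl | hv)
      · exact P.not_adj_of_mem (P.y_mem 0) (P.y_mem _) (hne j)
      · exact P.not_adj_inner hv (P.y_mem _))
    (fun i j hij => P.not_adj_of_mem (P.y_mem _) (P.y_mem _)
      (P.comp_ne fun h => hij (Fin.succ_injective _ h).symm))
  have hsub : ∀ Q ⊆ A, G.IsClique Q → Q.ncard ≤ 1 := by
    intro Q hQ hQc
    rw [Set.ncard_le_one]
    intro v hv w hw
    by_contra hvw
    have hadj := hQc hv hw hvw
    rcases hQ hv with rfl | hv' <;> rcases hQ hw with rfl | hw'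
    · exact hvw rfl
    · exact (P.not_adj_inner hw' (P.y_mem 0)).2 hadj.symm
    · exact (P.not_adj_inner hv' (P.y_mem 0)).2 hadj
    · obtain ⟨C, hC', hvC⟩ := hv'
      have hlt := hC C (mem_nonExterior.2 hC')
      rw [← C.ncard_verts, Nat.lt_succ_iff, Set.ncard_le_one] at hlt
      exact hvw (hlt v hvC w (mem_verts_of_adj hvC (hAz w (hQ hw)).ne' hadj))
  have hQR : (Q ∪ R).ncard + k ≤ 2 := by
    have hQ1 := hsub Q hQ hQc
    have hR1 := hsub R hR hRc
    have := Set.ncard_union_le Q R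
    by_cases hk1 : 1 ≤ k
    · rw [h1 hk1, Set.empty_union] at *
      omega
    · omega
  rw [hA, Set.ncard_insert_of_notMem hyA (Set.toFinite _), ncard_innerVerts] at hcard
  have hsum : (nonExterior G z).card ≤ ∑ C ∈ nonExterior G z, C.order := by
    simpa using Finset.card_nsmul_le_sum (nonExterior G z) LocalComponent.order 1
      fun C _ => C.order_pos
  have hn := card_localComponent (G := G) (z := z)
  rw [P.card_exterior] at hn
  obtain ⟨T, hT, hTcard⟩ := Finset.exists_subset_card_eq
    (s := nonExterior G z) (n := Nat.card (LocalComponent G z) - 2) (by omega)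
  have hw := wtAt_le_sum hT hTcard.ge
  have hTsum : ∑ C ∈ T, C.order ≤ T.card := by
    simpa using Finset.sum_le_card_nsmul T LocalComponent.order 1
      fun C h => Nat.lt_succ_iff.1 (hC C (hT h))
  have := hcrit {P.x 0}ᶜ (by simp)
  omega

/-- If no proper induced subgraph has impropriety at least the weight of `z`, then there are many
cliques among the largest non-exterior local components at `z`. -/
theorem exists_max_cliques {k : ℕ} (P : PendantPairs G z k) (hI : IsIntervalGraph G)
    (hcrit : ∀ S : Set V, S ≠ Set.univ → imp (G.induce S) < wtAt G z) (hk : k ≤ 1) :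
    ∃ T ⊆ nonExterior G z, T.card = 3 - k ∧
      ∀ C ∈ T, G.IsClique C.verts ∧ ∀ D ∈ nonExterior G z, D.order ≤ C.order := by
  classical
  have hpos : 0 < wtAt G z := by
    have := hcrit ∅ (fun h => (h ▸ Set.mem_univ z : z ∈ (∅ : Set V)))
    omega
  have hn := card_localComponent (G := G) (z := z)
  rw [P.card_exterior] at hn
  have hn3 : 3 ≤ Nat.card (LocalComponent G z) := by
    by_contra! h
    have := wtAt_le_sum (G := G) (z := z) (T := ∅) (by simp) (by simp; omega)
    simp at this
    omega
  set M : LocalComponent G z → Prop := fun C => C ∈ nonExterior G z ∧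
    ∀ D ∈ nonExterior G z, D.order ≤ C.order with hM
  obtain ⟨C₀, hC₀, hpref⟩ : ∃ C₀, M C₀ ∧
      ∀ C, M C → G.IsClique C.verts → G.IsClique C₀.verts := by
    by_cases h : ∃ C, M C ∧ G.IsClique C.verts
    · obtain ⟨C, hC, hCc⟩ := h
      exact ⟨C, hC, fun _ _ _ => hCc⟩
    · obtain ⟨C, hC, hCm⟩ := (nonExterior G z).exists_max_image LocalComponent.order
        (Finset.card_pos.1 (by omega))
      exact ⟨C, ⟨hC, hCm⟩, fun D hD hDc => (h ⟨D, hD, hDc⟩).elim⟩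
  obtain ⟨v, hv⟩ := C₀.verts_nonempty
  have hvA : v ∈ innerVerts G z := ⟨C₀, mem_nonExterior.1 hC₀.1, hv⟩
  obtain ⟨-, Q, R, hQ, hR, hQc, hRc, hcard, h1, -⟩ := P.exists_cliques hI (S := {v}ᶜ)
    (A := innerVerts G z \ {v}) (fun h => ne_of_mem_verts hv h.symm) (fun w hw => hw.2)
    Set.sdiff_subset (fun j h => (P.not_adj_inner hvA (P.x_mem j)).1 h.symm)
    (fun j h => (P.not_adj_inner hvA (P.y_mem j)).1 h.symm)
  have hvQ : v ∉ Q := fun h => (hQ h).2 rfl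
  have hvR : v ∉ R := fun h => (hR h).2 rfl
  have hcr := hcrit {v}ᶜ (by simp)
  have hA := Set.ncard_sdiff_singleton_add_one hvA (Set.toFinite _)
  have hD : ∀ D ⊆ nonExterior G z, D.card + k ≤ 2 → ∑ C ∈ D, C.order ≤ (Q ∪ R).ncard := by
    intro D hD hDc
    have := wtAt_add_sum_le hD (by rwa [P.card_exterior])
    omega
  have hQA : Q ⊆ innerVerts G z := hQ.trans Set.sdiff_subset
  have hRA : R ⊆ innerVerts G z := hR.trans Set.sdiff_subset
  have hfull : ∀ (X : Set V) (C : LocalComponent G z), G.IsClique X → C ∈ nonExterior G z →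
      X ⊆ C.verts → v ∉ X → C₀.order ≤ X.ncard → M C ∧ G.IsClique C.verts ∧ C ≠ C₀ := by
    intro X C hX hC hXC hvX hle
    have hCC := hC₀.2 C hC
    have hXeq : X = C.verts := Set.eq_of_subset_of_ncard_le hXC
      (by rw [C.ncard_verts]; omega) (Set.toFinite _)
    refine ⟨⟨hC, fun D hD => (hC₀.2 D hD).trans ?_⟩, hXeq ▸ hX, ?_⟩
    · rw [← C.ncard_verts, ← hXeq]
      exact hle
    · rintro rfl
      exact hvX (hXeq ▸ hv)
  have hlt : ∀ X : Set V, X ⊆ C₀.verts → v ∉ X → X.ncard < C₀.order := by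
    intro X hX hvX
    rw [← C₀.ncard_verts]
    exact Set.ncard_lt_ncard ((Set.ssubset_iff_of_subset hX).2 ⟨v, hv, hvX⟩) (Set.toFinite _)
  have hle : ∀ (X : Set V) (C : LocalComponent G z), X ⊆ C.verts → X.ncard ≤ C.order := by
    intro X C hX
    rw [← C.ncard_verts]
    exact Set.ncard_le_ncard hX (Set.toFinite _)
  have hpos₀ := C₀.order_pos
  obtain rfl | rfl : k = 0 ∨ k = 1 := by omega
  · have hpair : ∀ C ∈ nonExterior G z, C ≠ C₀ → C₀.order + C.order ≤ (Q ∪ R).ncard := by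
      intro C hC hne
      have := hD {C₀, C} (by simp [Finset.insert_subset_iff, hC₀.1, hC])
        (by rw [Finset.card_pair hne.symm])
      rwa [Finset.sum_pair hne.symm] at this
    obtain ⟨C', hC', hne'⟩ := (nonExterior G z).exists_mem_ne (by omega) C₀
    have hC'pos := C'.order_pos
    have hlt' := hpair C' hC' hne'
    have hun := Set.ncard_union_le Q R
    have hQne : Q.Nonempty := by
      by_contra! h
      rw [h, Set.empty_union] at hlt'
      have hRne : R.Nonempty := Set.nonempty_of_ncard_ne_zero (by omega)
      obtain ⟨C, hC, hRC⟩ := exists_mem_nonExterior hRc hRA hRne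
      have := hle R C hRC
      have := hC₀.2 C hC
      omega
    have hRne : R.Nonempty := by
      by_contra! h
      rw [h, Set.union_empty] at hlt'
      obtain ⟨C, hC, hQC⟩ := exists_mem_nonExterior hQc hQA hQne
      have := hle Q C hQC
      have := hC₀.2 C hC
      omega
    obtain ⟨C₁, hC₁, hQC⟩ := exists_mem_nonExterior hQc hQA hQne
    obtain ⟨C₂, hC₂, hRC⟩ := exists_mem_nonExterior hRc hRA hRne
    have hQ1 := hle Q C₁ hQC
    have hR2 := hle R C₂ hRC
    have hm1 := hC₀.2 C₁ hC₁
    have hm2 := hC₀.2 C₂ hC₂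
    have h12 : C₁ ≠ C₂ := by
      rintro rfl
      have := hle (Q ∪ R) C₁ (Set.union_subset hQC hRC)
      omega
    have h10 : C₁ ≠ C₀ := by
      rintro rfl
      have := hpair C₂ hC₂ h12.symm
      have := hlt Q hQC hvQ
      omega
    have h20 : C₂ ≠ C₀ := by
      rintro rfl
      have := hpair C₁ hC₁ h12
      have := hlt R hRC hvR
      omega
    have hp1 := hpair C₁ hC₁ h10
    have hp2 := hpair C₂ hC₂ h20
    obtain ⟨hM1, hc1, -⟩ := hfull Q C₁ hQc hC₁ hQC hvQ (by omega)
    obtain ⟨hM2, hc2, -⟩ := hfull R C₂ hRc hC₂ hRC hvR (by omega)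
    refine ⟨{C₀, C₁, C₂}, by simp [Finset.insert_subset_iff, hC₀.1, hC₁, hC₂],
      Finset.card_eq_three.2 ⟨C₀, C₁, C₂, h10.symm, h20.symm, h12, rfl⟩, ?_⟩
    intro C hC
    simp only [Finset.mem_insert, Finset.mem_singleton] at hC
    rcases hC with rfl | rfl | rfl
    · exact ⟨hpref C₁ hM1 hc1, hC₀.2⟩
    · exact ⟨hc1, hM1.2⟩
    · exact ⟨hc2, hM2.2⟩
  · have hle₀ := hD {C₀} (by simpa using hC₀.1) (by simp)
    rw [h1 le_rfl, Set.empty_union, Finset.sum_singleton] at hle₀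
    have hRne : R.Nonempty := Set.nonempty_of_ncard_ne_zero (by omega)
    obtain ⟨C₂, hC₂, hRC⟩ := exists_mem_nonExterior hRc hRA hRne
    obtain ⟨hM2, hc2, h20⟩ := hfull R C₂ hRc hC₂ hRC hvR hle₀
    refine ⟨{C₀, C₂}, by simp [Finset.insert_subset_iff, hC₀.1, hC₂],
      Finset.card_pair h20.symm, ?_⟩
    intro C hC
    simp only [Finset.mem_insert, Finset.mem_singleton] at hC
    rcases hC with rfl | rfl
    · exact ⟨hpref C₂ hM2 hc2, hC₀.2⟩
    · exact ⟨hc2, hM2.2⟩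

end PendantPairs

end Critical

section BAL

variable {n : ℕ} {W : Fin n → Type u} {k : ℕ} {H : ∀ i, SimpleGraph (W i)}

theorem BAL_adj {v w : BalVertex W k} :
    (BAL k H).Adj v w ↔ v ≠ w ∧ (BalRel H k v w ∨ BalRel H k w v) := SimpleGraph.fromRel_adj ..

@[simp] theorem BAL_adj_z_inner {i : Fin n} {w : W i} : (BAL k H).Adj .z (.inner i w) :=
  BAL_adj.2 ⟨by simp, .inl (.z_inner i w)⟩

@[simp] theorem BAL_adj_z_y {j : Fin k} : (BAL k H).Adj .z (.y j) :=
  BAL_adj.2 ⟨by simp, .inl (.z_y j)⟩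

@[simp] theorem BAL_not_adj_z_x {j : Fin k} : ¬ (BAL k H).Adj .z (.x j) := by
  rw [BAL_adj]
  rintro ⟨-, h | h⟩ <;> cases h

@[simp] theorem BAL_adj_inner_inner {i : Fin n} {w w' : W i} :
    (BAL k H).Adj (.inner i w) (.inner i w') ↔ (H i).Adj w w' := by
  rw [BAL_adj]
  constructor
  · rintro ⟨-, h | h⟩
    · cases h with
      | inner_inner _ _ _ h => exact h
    · cases h with
      | inner_inner _ _ _ h => exact h.symm
  · intro h
    exact ⟨by simpa using h.ne, .inl (.inner_inner i w w' h)⟩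

theorem BAL_not_adj_inner_inner {i j : Fin n} (hij : i ≠ j) {w : W i} {w' : W j} :
    ¬ (BAL k H).Adj (.inner i w) (.inner j w') := by
  rw [BAL_adj]
  rintro ⟨-, h | h⟩ <;> cases h <;> exact hij rfl

@[simp] theorem BAL_not_adj_inner_y {i : Fin n} {w : W i} {j : Fin k} :
    ¬ (BAL k H).Adj (.inner i w) (.y j) := by
  rw [BAL_adj]
  rintro ⟨-, h | h⟩ <;> cases h

@[simp] theorem BAL_not_adj_inner_x {i : Fin n} {w : W i} {j : Fin k} :
    ¬ (BAL k H).Adj (.inner i w) (.x j) := by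
  rw [BAL_adj]
  rintro ⟨-, h | h⟩ <;> cases h

@[simp] theorem BAL_not_adj_y_y {i j : Fin k} : ¬ (BAL k H).Adj (.y i) (.y j) := by
  rw [BAL_adj]
  rintro ⟨-, h | h⟩ <;> cases h

@[simp] theorem BAL_not_adj_x_x {i j : Fin k} : ¬ (BAL k H).Adj (.x i) (.x j) := by
  rw [BAL_adj]
  rintro ⟨-, h | h⟩ <;> cases h

@[simp] theorem BAL_adj_y_x {i j : Fin k} : (BAL k H).Adj (.y i) (.x j) ↔ i = j := by
  rw [BAL_adj]
  constructor
  · rintro ⟨-, h | h⟩ <;> cases h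
    rfl
  · rintro rfl
    exact ⟨by simp, .inl (.y_x i)⟩

end BAL

section Decomposition

variable {V : Type u} [Finite V] {G : SimpleGraph V} {z : V}

/-- A graph whose exterior local components at `z` are pendant pairs is of the form `BAL`. -/
theorem PendantPairs.exists_iso {k : ℕ} (P : PendantPairs G z k) (hI : IsIntervalGraph G)
    (hall : ∀ v, v = z ∨ v ∈ innerVerts G z ∨ ∃ j, v = P.x j ∨ v = P.y j) :
    ∃ e : Fin (nonExterior G z).card ≃ {C // C ∈ nonExterior G z},
      IsConnIntervalSeq (fun i => (e i).1.toSimpleGraph) ∧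
      Nonempty (G ≃g BAL k fun i => (e i).1.toSimpleGraph) := by
  let e := (nonExterior G z).equivFin.symm
  refine ⟨e, fun i => ⟨inferInstance, (e i).1.connected_toSimpleGraph, ?_⟩, ?_⟩
  · exact hI.of_embedding ((SimpleGraph.Embedding.induce _).trans (SimpleGraph.Embedding.induce _))
  let f : BalVertex (fun i => (e i).1.supp) k → V := fun v =>
    match v with
    | .z => z
    | .inner i w => w.1.1
    | .y j => P.y j
    | .x j => P.x j
  have hmem : ∀ i (w : (e i).1.supp), w.1.1 ∈ (e i).1.verts := fun i w => ⟨w.1, w.2, rfl⟩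
  have hinner : ∀ i (w : (e i).1.supp), w.1.1 ∈ innerVerts G z := fun i w =>
    ⟨_, mem_nonExterior.1 (e i).2, hmem i w⟩
  have hpair : ∀ {i j : Fin k} {v w : V}, v ∈ (P.comp i).1.verts → w ∈ (P.comp j).1.verts →
      i ≠ j → v ≠ w ∧ ¬ G.Adj v w := fun hv hw h =>
    P.not_adj_of_mem hv hw fun h' => P.comp_ne h h'.symm
  have hij : ∀ i j (w : (e i).1.supp) (w' : (e j).1.supp), i ≠ j →
      w.1.1 ≠ w'.1.1 ∧ ¬ G.Adj w.1.1 w'.1.1 := by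
    intro i j w w' h
    have hC : (e i).1 ≠ (e j).1 := fun h' => h (e.injective (Subtype.ext h'))
    refine ⟨fun h' => hC (eq_of_mem_verts (hmem i w) (h' ▸ hmem j w')), fun h' => ?_⟩
    exact hC (eq_of_mem_verts (mem_verts_of_adj (hmem i w) (ne_of_mem_verts (hmem j w')) h')
      (hmem j w'))
  have hxy : ∀ i j, P.x i ≠ P.y j := fun i j h => P.not_adj_z i (h ▸ P.adj_z j)
  have hinj : Function.Injective f := by
    rintro (_ | ⟨i, w⟩ | j | j) (_ | ⟨i', w'⟩ | j' | j') h
    · rfl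
    · exact (ne_of_mem_verts (hmem i' w') h.symm).elim
    · exact (P.y_ne j' h.symm).elim
    · exact (P.x_ne j' h.symm).elim
    · exact (ne_of_mem_verts (hmem i w) h).elim
    · obtain rfl : i = i' := by
        by_contra hne
        exact (hij i i' w w' hne).1 h
      rw [Subtype.ext (Subtype.ext h)]
    · exact ((P.not_adj_inner (hinner i w) (P.y_mem j')).1 h).elim
    · exact ((P.not_adj_inner (hinner i w) (P.x_mem j')).1 h).elim
    · exact (P.y_ne j h).elim
    · exact ((P.not_adj_inner (hinner i' w') (P.y_mem j)).1 h.symm).elim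
    · by_contra hne
      exact (hpair (P.y_mem j) (P.y_mem j') fun h' => hne (h' ▸ rfl)).1 h
    · exact (hxy _ _ h.symm).elim
    · exact (P.x_ne j h).elim
    · exact ((P.not_adj_inner (hinner i' w') (P.x_mem j)).1 h.symm).elim
    · exact (hxy _ _ h).elim
    · by_contra hne
      exact (hpair (P.x_mem j) (P.x_mem j') fun h' => hne (h' ▸ rfl)).1 h
  have hsurj : Function.Surjective f := by
    intro v
    rcases hall v with rfl | ⟨C, hC, ⟨w, hw, rfl⟩⟩ | ⟨j, rfl | rfl⟩
    · exact ⟨.z, rfl⟩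
    · have : (e (e.symm ⟨C, mem_nonExterior.2 hC⟩)).1 = C := by simp
      exact ⟨.inner (e.symm ⟨C, mem_nonExterior.2 hC⟩) ⟨w, by rwa [this]⟩, rfl⟩
    · exact ⟨.x j, rfl⟩
    · exact ⟨.y j, rfl⟩
  have hadj : ∀ v w, G.Adj (f v) (f w) ↔ (BAL k fun i => (e i).1.toSimpleGraph).Adj v w := by
    have hyx : ∀ j j', G.Adj (P.y j) (P.x j') ↔ j = j' := by
      intro j j'
      constructor
      · intro h
        by_contra hne
        exact (hpair (P.y_mem j) (P.x_mem j') hne).2 h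
      · rintro rfl
        exact P.adj j
    have hyy : ∀ j j', ¬ G.Adj (P.y j) (P.y j') := by
      intro j j' h
      by_cases hj : j = j'
      · exact h.ne (hj ▸ rfl)
      · exact (hpair (P.y_mem j) (P.y_mem j') hj).2 h
    have hxx : ∀ j j', ¬ G.Adj (P.x j) (P.x j') := by
      intro j j' h
      by_cases hj : j = j'
      · exact h.ne (hj ▸ rfl)
      · exact (hpair (P.x_mem j) (P.x_mem j') hj).2 h
    have hiy := fun i (w : (e i).1.supp) j => (P.not_adj_inner (hinner i w) (P.y_mem j)).2
    have hix := fun i (w : (e i).1.supp) j => (P.not_adj_inner (hinner i w) (P.x_mem j)).2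
    rintro (_ | ⟨i, w⟩ | j | j) (_ | ⟨i', w'⟩ | j' | j')
    · simp
    · exact iff_of_true (adj_of_mem_innerVerts (hinner i' w')) BAL_adj_z_inner
    · exact iff_of_true (P.adj_z j') BAL_adj_z_y
    · exact iff_of_false (P.not_adj_z j') BAL_not_adj_z_x
    · exact iff_of_true (adj_of_mem_innerVerts (hinner i w)).symm BAL_adj_z_inner.symm
    · by_cases h : i = i'
      · subst h
        rw [BAL_adj_inner_inner]
        rfl
      · exact iff_of_false (hij i i' w w' h).2 (BAL_not_adj_inner_inner h)
    · exact iff_of_false (hiy i w j') BAL_not_adj_inner_y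
    · exact iff_of_false (hix i w j') BAL_not_adj_inner_x
    · exact iff_of_true (P.adj_z j).symm BAL_adj_z_y.symm
    · exact iff_of_false (fun h => hiy i' w' j h.symm) fun h => BAL_not_adj_inner_y h.symm
    · exact iff_of_false (hyy j j') BAL_not_adj_y_y
    · exact (hyx j j').trans BAL_adj_y_x.symm
    · exact iff_of_false (fun h => P.not_adj_z j h.symm) fun h => BAL_not_adj_z_x h.symm
    · exact iff_of_false (fun h => hix i' w' j h.symm) fun h => BAL_not_adj_inner_x h.symm
    · rw [SimpleGraph.adj_comm, SimpleGraph.adj_comm (BAL k _)]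
      exact (hyx j' j).trans BAL_adj_y_x.symm
    · exact iff_of_false (hxx j j') BAL_not_adj_x_x
  exact ⟨(⟨Equiv.ofBijective f ⟨hinj, hsurj⟩, fun {v w} => hadj v w⟩ : BAL k _ ≃g G).symm⟩

theorem exists_iso_BAL {p : ℕ} (hcrit : IsCritical G p) (hbal : IsBalanced G) :
    ∃ k ≤ 2, ∃ (n : ℕ) (W : Fin n → Type u) (H : ∀ i, SimpleGraph (W i)),
      IsConnIntervalSeq H ∧ (1 ≤ k → MaxOrderGeTwo W) ∧ (k ≤ 1 → HasMaxCliques H (3 - k)) ∧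
      Nonempty (G ≃g BAL k H) := by
  have hconn := hcrit.connected
  obtain ⟨hp, hI, himp, hS⟩ := hcrit
  have := hconn.nonempty
  obtain ⟨z, hz⟩ := exists_eq_ciSup_of_finite (f := wtAt G)
  change wtAt G z = wt G at hz
  have hzp : wtAt G z = p := hz.trans (hbal.2.trans himp)
  rw [← hzp] at hS
  obtain ⟨P⟩ := exists_pendantPairs hconn z
  generalize Nat.card {C : LocalComponent G z // C.IsExterior} = k at P
  obtain ⟨e, hH, hiso⟩ := P.exists_iso hI (P.eq_or_mem hI hS)
  refine ⟨k, P.card_le_two hI, _, _, _, hH, fun hk => ?_, fun hk => ?_, hiso⟩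
  · obtain ⟨k, rfl⟩ := Nat.exists_eq_add_of_le' hk
    obtain ⟨C, hC, h2⟩ := P.exists_two_le_order hI hS
    refine ⟨e.symm ⟨C, hC⟩, ?_⟩
    have : (e (e.symm ⟨C, hC⟩)).1 = C := by simp
    exact h2.trans_eq (congrArg LocalComponent.order this.symm)
  · classical
    obtain ⟨T, hT, hcard, hmax⟩ := P.exists_max_cliques hI hS hk
    refine ⟨Finset.univ.filter fun i => (e i).1 ∈ T, ?_, fun i hi => ?_⟩
    · rw [← hcard]
      refine Finset.card_bij (fun i _ => (e i).1) (by simp)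
        (fun i _ j _ h => e.injective (Subtype.ext h)) fun C hC => ?_
      exact ⟨e.symm ⟨C, hT hC⟩, by simpa using hC, by simp⟩
    · obtain ⟨hcl, hle⟩ := hmax (e i).1 (Finset.mem_filter.1 hi).2
      refine ⟨?_, fun j => hle (e j).1 (e j).2⟩
      ext v w
      refine ⟨fun h => h.ne, fun h => ?_⟩
      exact hcl ⟨v.1, v.2, rfl⟩ ⟨w.1, w.2, rfl⟩
        fun h' => h (Subtype.ext (Subtype.ext h'))

end Decomposition
/-- An interval graph has a representation in which all intervals reach the left half-line, while a
clique, or two vertices of a connected graph, reach the open right half-line. -/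
theorem IsIntervalGraph.exists_endpoints {W : Type u} [Finite W] {H : SimpleGraph W}
    (hH : IsIntervalGraph H) :
    ∃ l r : W → ℝ, (∀ w, -2 < l w ∧ l w ≤ 0 ∧ l w ≤ r w ∧ r w < 2) ∧
      (∀ v w, v ≠ w → (H.Adj v w ↔ l v ≤ r w ∧ l w ≤ r v)) ∧ (H = ⊤ → ∀ w, 0 < r w) ∧
      (H.Connected → 2 ≤ Nat.card W → ∃ v w, v ≠ w ∧ 0 < r v ∧ 0 < r w) := by
  obtain ⟨a⟩ := hH
  rcases isEmpty_or_nonempty W with hW | hW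
  · exact ⟨0, 0, isEmptyElim, isEmptyElim, fun _ => isEmptyElim, fun _ h => by simp at h⟩
  obtain ⟨u, hu⟩ := Finite.exists_max a.l
  have hle : ∀ {s t : ℝ}, Real.arctan s ≤ Real.arctan t ↔ s ≤ t := Real.arctan_le_arctan_iff
  have hlo : ∀ t, -2 < Real.arctan t := fun t => by
    linarith [Real.neg_pi_div_two_lt_arctan t, Real.pi_le_four]
  have hneg : ∀ {t : ℝ}, t ≤ 0 → Real.arctan t ≤ 0 := fun {t} ht => by
    have := hle.2 ht
    rwa [Real.arctan_zero] at this
  let l : W → ℝ := fun w => Real.arctan (a.l w - a.l u)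
  let r : W → ℝ := fun w => if a.l u ≤ a.r w then 1 else Real.arctan (a.r w - a.l u)
  have hr1 : ∀ w, a.l u ≤ a.r w → r w = 1 := fun w h => if_pos h
  have hr2 : ∀ w, ¬ a.l u ≤ a.r w → r w = Real.arctan (a.r w - a.l u) := fun w h => if_neg h
  have hl0 : ∀ w, l w ≤ 0 := fun w => hneg (sub_nonpos.2 (hu w))
  have hlr : ∀ v w, l v ≤ r w ↔ a.l v ≤ a.r w := by
    intro v w
    by_cases h : a.l u ≤ a.r w
    · rw [hr1 w h]
      exact iff_of_true ((hl0 v).trans zero_le_one) ((hu v).trans h)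
    · rw [hr2 w h]
      exact hle.trans (sub_le_sub_iff_right _)
  have hclose : ∀ w, w = u ∨ H.Adj u w → 0 < r w := by
    rintro w (rfl | h)
    · rw [hr1 w (a.l_le_r w)]
      exact one_pos
    · rw [hr1 w ((a.adj_iff_le h.ne).1 h).1]
      exact one_pos
  refine ⟨l, r, fun w => ⟨hlo _, hl0 w, (hlr w w).2 (a.l_le_r w), ?_⟩, fun v w hvw => ?_,
    fun h w => hclose w ?_, fun hc h2 => ?_⟩
  · by_cases h : a.l u ≤ a.r w
    · rw [hr1 w h]
      exact one_lt_two
    · rw [hr2 w h]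
      exact (hneg (by linarith)).trans_lt two_pos
  · rw [hlr, hlr]
    exact a.adj_iff_le hvw
  · by_cases hw : w = u
    · exact .inl hw
    · exact .inr (by rw [h]; exact Ne.symm hw)
  · have : Nontrivial W := Finite.one_lt_card_iff_nontrivial.1 h2
    obtain ⟨w, hw⟩ := hc.preconnected.exists_adj_of_nontrivial u
    exact ⟨u, w, hw.ne, hclose u (.inl rfl), hclose w (.inr hw)⟩

section BAL

variable {n : ℕ} {W : Fin n → Type u} {k : ℕ} {H : ∀ i, SimpleGraph (W i)}

instance [∀ i, Finite (W i)] : Finite (BalVertex W k) := by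
  let f : BalVertex W k → Option ((Σ i, W i) ⊕ (Fin k ⊕ Fin k)) := fun v =>
    match v with
    | .z => none
    | .inner i w => some (.inl ⟨i, w⟩)
    | .y j => some (.inr (.inl j))
    | .x j => some (.inr (.inr j))
  refine Finite.of_injective f ?_
  rintro (_ | ⟨i, w⟩ | j | j) (_ | ⟨i', w'⟩ | j' | j') h <;> simp [f] at h ⊢
  · exact h
  · exact h
  · exact h

theorem BAL_connected : (BAL k H).Connected := by
  have hz : ∀ v, (BAL k H).Reachable .z v := by
    have hy : ∀ j, (BAL k H).Reachable .z (.y j) := fun j => BAL_adj_z_y.reachable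
    rintro (_ | ⟨i, w⟩ | j | j)
    · rfl
    · exact BAL_adj_z_inner.reachable
    · exact hy j
    · exact (hy j).trans (BAL_adj_y_x.2 rfl).reachable
  have : Nonempty (BalVertex W k) := ⟨.z⟩
  exact ⟨fun v w => (hz v).symm.trans (hz w)⟩

/-- The vertices of the graph `H i` in `BAL`. -/
def balPiece (W : Fin n → Type u) (k : ℕ) (i : Fin n) : Set (BalVertex W k) :=
  Set.range (BalVertex.inner i)

/-- The vertices of all the graphs `H i` in `BAL`. -/
def balInner (W : Fin n → Type u) (k : ℕ) : Set (BalVertex W k) := ⋃ i, balPiece W k i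

theorem balPiece_subset (i : Fin n) : balPiece W k i ⊆ balInner W k :=
  Set.subset_iUnion (balPiece W k) i

theorem mem_balInner {i : Fin n} {w : W i} : .inner i w ∈ balInner W k :=
  balPiece_subset i ⟨w, rfl⟩

theorem ncard_balPiece (i : Fin n) : (balPiece W k i).ncard = Nat.card (W i) := by
  rw [balPiece, ← Set.image_univ, Set.ncard_image_of_injective _ (by intro a b h; simpa using h),
    Set.ncard_univ]

theorem disjoint_balPiece {i j : Fin n} (h : i ≠ j) :
    Disjoint (balPiece W k i) (balPiece W k j) := by
  rw [Set.disjoint_left]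
  rintro _ ⟨w, rfl⟩ ⟨w', hw'⟩
  cases hw'
  exact h rfl

/-- The endpoints of a pendant pair in one of three slots: at the left end of `[-N, N]`, at the
right end, or torn apart with `y` inside and `x` outside. -/
structure Slot (N : ℝ) where
  yl : ℝ
  yr : ℝ
  xl : ℝ
  xr : ℝ

/-- The three slots. -/
def slot (N : ℝ) : Fin 3 → Slot N :=
  ![⟨-N - 1, -N, -N - 2, -N - 1⟩, ⟨N, N + 1, N + 1, N + 2⟩, ⟨0, 0, N + 4, N + 4⟩]

theorem fin_three_cases (t : Fin 3) : t = 0 ∨ t = 1 ∨ t = 2 := by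
  omega

theorem slot_le (N : ℝ) (t : Fin 3) :
    (slot N t).yl ≤ (slot N t).yr ∧ (slot N t).xl ≤ (slot N t).xr := by
  rcases fin_three_cases t with rfl | rfl | rfl <;> simp only [slot, Matrix.cons_val] <;>
    constructor <;> linarith

theorem slot_y_z {N : ℝ} (hN : 12 ≤ N) (t : Fin 3) :
    (-N ≤ (slot N t).yr ∧ (slot N t).yl ≤ N) ∧ ¬ ((slot N t).yl ≤ -N ∧ N ≤ (slot N t).yr) ∧
      (t ≠ 2 → ¬ (-N ≤ (slot N t).yl ∧ (slot N t).yr ≤ N)) := by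
  rcases fin_three_cases t with rfl | rfl | rfl <;> simp [slot] <;> (try constructor) <;> linarith

theorem slot_x_z {N : ℝ} (t : Fin 3) : (slot N t).xr < -N ∨ N < (slot N t).xl := by
  rcases fin_three_cases t with rfl | rfl | rfl <;> simp [slot]

theorem slot_ne {N : ℝ} (hN : 12 ≤ N) {t t' : Fin 3} (h : t ≠ t') :
    ¬ ((slot N t).yl ≤ (slot N t').yr ∧ (slot N t').yl ≤ (slot N t).yr) ∧
    ¬ ((slot N t).xl ≤ (slot N t').xr ∧ (slot N t').xl ≤ (slot N t).xr) ∧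
    ¬ ((slot N t).yl ≤ (slot N t').xr ∧ (slot N t').xl ≤ (slot N t).yr) := by
  rcases fin_three_cases t with rfl | rfl | rfl <;>
    rcases fin_three_cases t' with rfl | rfl | rfl <;>
    first
    | exact (h rfl).elim
    | (simp only [slot, Matrix.cons_val]
       refine ⟨fun h => ?_, fun h => ?_, fun h => ?_⟩ <;> linarith [h.1, h.2])

theorem slot_y_x {N : ℝ} {t : Fin 3} (h : t ≠ 2) :
    (slot N t).yl ≤ (slot N t).xr ∧ (slot N t).xl ≤ (slot N t).yr := by
  rcases fin_three_cases t with rfl | rfl | rfl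
  · simp only [slot, Matrix.cons_val]
    constructor <;> linarith
  · simp only [slot, Matrix.cons_val]
    constructor <;> linarith
  · exact (h rfl).elim

/-- Where an interval of a graph `H i` may lie so as not to meet the pendant pairs. -/
theorem slot_free {N l r : ℝ} {t : Fin 3} (h0 : t = 0 → -N < l)
    (h1 : t = 1 → r < N) (h2 : r < 0 ∨ 0 < l) (h3 : r < N + 2) :
    ¬ (l ≤ (slot N t).yr ∧ (slot N t).yl ≤ r) ∧ ¬ (l ≤ (slot N t).xr ∧ (slot N t).xl ≤ r) := by
  rcases fin_three_cases t with rfl | rfl | rfl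
  · have := h0 rfl
    simp only [slot, Matrix.cons_val]
    constructor <;> intro h <;> linarith [h.1, h.2]
  · have := h1 rfl
    simp only [slot, Matrix.cons_val]
    constructor <;> intro h <;> linarith [h.1, h.2]
  · simp only [slot, Matrix.cons_val]
    constructor
    · intro h
      rcases h2 with h2 | h2 <;> linarith [h.1, h.2]
    · intro h
      linarith [h.1, h.2]

theorem exists_placement [∀ i, Finite (W i)] (hI : ∀ i, IsIntervalGraph (H i))
    (eL eR : Option (Fin n)) (hLR : ∀ i, eL = some i → eR ≠ some i) (τ : Fin k → Fin 3)
    (hτ : Function.Injective τ) (hτ0 : ∀ j, τ j = 0 → eL = none)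
    (hτ1 : ∀ j, τ j = 1 → eR = none) :
    ∃ Z : Set (BalVertex W k),
      (∀ (S : Set (BalVertex W k)) (q : ℕ), (∀ j, τ j = 2 → .x j ∉ S ∨ .y j ∉ S) →
        (∀ i, Nat.card (W i) ≤ q + 1) → (k ≠ 0 → 1 ≤ q) → (.z ∈ S → (Z ∩ S).ncard ≤ q) →
        imp ((BAL k H).induce S) ≤ q) ∧
      (∀ v ∈ Z, v ∈ balInner W k ∨ ∃ j, τ j = 2 ∧ v = .y j) ∧
      (∀ i, (eL = some i ∨ eR = some i) → H i = ⊤ → ∀ w, .inner i w ∉ Z) ∧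
      (∀ i, (eL = some i ∨ eR = some i) → (H i).Connected → 2 ≤ Nat.card (W i) →
        ∃ v w : W i, v ≠ w ∧ .inner i v ∉ Z ∧ .inner i w ∉ Z) ∧
      ((∀ j, τ j ≠ 2) → IsIntervalGraph (BAL k H)) := by
  choose l r hb hadj htop hconn using fun i => (hI i).exists_endpoints
  obtain ⟨N, hN⟩ : ∃ N : ℝ, N = 4 * ((n : ℝ) + 3) := ⟨_, rfl⟩
  have hn : (0 : ℝ) ≤ n := Nat.cast_nonneg n
  have hN12 : 12 ≤ N := by linarith
  let pos : Fin n → ℝ := fun i =>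
    if eL = some i then -N else if eR = some i then N else 4 * ((i : ℝ) + 1)
  let lo : ∀ i, W i → ℝ := fun i w => if eL = some i then pos i - r i w else pos i + l i w
  let hi : ∀ i, W i → ℝ := fun i w => if eL = some i then pos i - l i w else pos i + r i w
  have hL : ∀ i, eL = some i → pos i = -N ∧
      ∀ w, lo i w = -N - r i w ∧ hi i w = -N - l i w := by
    intro i h
    simp [pos, lo, hi, h]
  have hR : ∀ i, eR = some i → pos i = N ∧ ∀ w, lo i w = N + l i w ∧ hi i w = N + r i w := by
    intro i h
    have h' : eL ≠ some i := fun h' => hLR i h' h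
    simp [pos, lo, hi, h, h']
  have hM : ∀ i, eL ≠ some i → eR ≠ some i → pos i = 4 * ((i : ℝ) + 1) ∧
      ∀ w, lo i w = 4 * ((i : ℝ) + 1) + l i w ∧ hi i w = 4 * ((i : ℝ) + 1) + r i w := by
    intro i h h'
    simp [pos, lo, hi, h, h']
  have hcases : ∀ i, eL = some i ∨ eR = some i ∨ (eL ≠ some i ∧ eR ≠ some i) := fun i => by
    tauto
  have hpos : ∀ i, pos i = -N ∨ (4 ≤ pos i ∧ pos i ≤ 4 * n) ∨ pos i = N := by
    intro i
    have hin : (i : ℝ) + 1 ≤ n := by exact_mod_cast i.2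
    rcases hcases i with h | h | h
    · exact .inl (hL i h).1
    · exact .inr (.inr (hR i h).1)
    · rw [(hM i h.1 h.2).1]
      have : (0 : ℝ) ≤ (i : ℝ) := Nat.cast_nonneg _
      exact .inr (.inl ⟨by linarith, by linarith⟩)
  have hwin : ∀ i w, pos i - 2 < lo i w ∧ lo i w ≤ hi i w ∧ hi i w < pos i + 2 := by
    intro i w
    obtain ⟨h1, h2, h3, h4⟩ := hb i w
    by_cases h : eL = some i
    · simp only [lo, hi, h, if_true]
      exact ⟨by linarith, by linarith, by linarith⟩
    · simp only [lo, hi, h, if_false]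
      exact ⟨by linarith, by linarith, by linarith⟩
  have hmeet : ∀ i w, -N ≤ hi i w ∧ lo i w ≤ N := by
    intro i w
    have hw := hwin i w
    obtain ⟨h1, h2, h3, h4⟩ := hb i w
    rcases hcases i with h | h | h
    · have := (hL i h).2 w
      exact ⟨by linarith, by linarith⟩
    · have := (hR i h).2 w
      exact ⟨by linarith, by linarith⟩
    · have h5 := (hM i h.1 h.2).1
      have hin : (i : ℝ) + 1 ≤ n := by exact_mod_cast i.2
      have hi0 : (0 : ℝ) ≤ (i : ℝ) := Nat.cast_nonneg _
      constructor <;> linarith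
  have hself : ∀ i v w, v ≠ w → ((H i).Adj v w ↔ lo i v ≤ hi i w ∧ lo i w ≤ hi i v) := by
    intro i v w hvw
    rw [hadj i v w hvw]
    by_cases h : eL = some i
    · simp only [lo, hi, h, if_true, sub_le_sub_iff_left]
      tauto
    · simp only [lo, hi, h, if_false, add_le_add_iff_left]
  have hsep : ∀ i j, i ≠ j → pos i + 4 ≤ pos j ∨ pos j + 4 ≤ pos i := by
    have hlt : ∀ i j : Fin n, i < j → (i : ℝ) + 1 ≤ j := fun i j h => by exact_mod_cast h
    have hin : ∀ i : Fin n, (i : ℝ) + 1 ≤ n := fun i => by exact_mod_cast i.2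
    have hi0 : ∀ i : Fin n, (0 : ℝ) ≤ (i : ℝ) := fun i => Nat.cast_nonneg _
    intro i j hij
    have a1 := hi0 i
    have a2 := hi0 j
    have a3 := hin i
    have a4 := hin j
    rcases hcases i with h | h | h <;> rcases hcases j with h' | h' | h'
    · exact (hij (Option.some_injective _ (h.symm.trans h'))).elim
    · rw [(hL i h).1, (hR j h').1]
      left
      linarith
    · rw [(hL i h).1, (hM j h'.1 h'.2).1]
      left
      linarith
    · rw [(hR i h).1, (hL j h').1]
      right
      linarith
    · exact (hij (Option.some_injective _ (h.symm.trans h'))).elim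
    · rw [(hR i h).1, (hM j h'.1 h'.2).1]
      right
      linarith
    · rw [(hM i h.1 h.2).1, (hL j h').1]
      right
      linarith
    · rw [(hM i h.1 h.2).1, (hR j h').1]
      left
      linarith
    · rw [(hM i h.1 h.2).1, (hM j h'.1 h'.2).1]
      rcases lt_or_gt_of_ne hij with h'' | h''
      · left
        linarith [hlt i j h'']
      · right
        linarith [hlt j i h'']
  have hfree : ∀ i w j, ¬ (lo i w ≤ (slot N (τ j)).yr ∧ (slot N (τ j)).yl ≤ hi i w) ∧
      ¬ (lo i w ≤ (slot N (τ j)).xr ∧ (slot N (τ j)).xl ≤ hi i w) := by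
    intro i w j
    have hw := hwin i w
    refine slot_free (fun h => ?_) (fun h => ?_) ?_ ?_
    · have h1 := hτ0 j h
      rcases hcases i with h' | h' | h'
      · rw [h1] at h'
        cases h'
      · linarith [(hR i h').1]
      · have := (hM i h'.1 h'.2).1
        rcases hpos i with h'' | h'' | h'' <;> linarith [(Nat.cast_nonneg i.1 : (0 : ℝ) ≤ (i : ℝ))]
    · have h1 := hτ1 j h
      rcases hcases i with h' | h' | h'
      · linarith [(hL i h').1]
      · rw [h1] at h'
        cases h'
      · have := (hM i h'.1 h'.2).1
        have hin : (i : ℝ) + 1 ≤ n := by exact_mod_cast i.2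
        linarith
    · rcases hpos i with h | h | h
      · left
        linarith
      · right
        linarith
      · right
        linarith
    · rcases hpos i with h | h | h <;> linarith
  let L : BalVertex W k → ℝ := fun v =>
    match v with
    | .z => -N
    | .inner i w => lo i w
    | .y j => (slot N (τ j)).yl
    | .x j => (slot N (τ j)).xl
  let R : BalVertex W k → ℝ := fun v =>
    match v with
    | .z => N
    | .inner i w => hi i w
    | .y j => (slot N (τ j)).yr
    | .x j => (slot N (τ j)).xr
  have hLR' : ∀ v, L v ≤ R v := by
    rintro (_ | ⟨i, w⟩ | j | j)
    · change -N ≤ N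
      linarith
    · exact (hwin i w).2.1
    · exact (slot_le N _).1
    · exact (slot_le N _).2
  have hyx : ∀ i j, (τ i ≠ 2 ∨ i ≠ j) → ((BAL k H).Adj (.y i) (.x j) ↔
      L (.y i) ≤ R (.x j) ∧ L (.x j) ≤ R (.y i)) := by
    intro i j hij
    rw [BAL_adj_y_x]
    by_cases h : i = j
    · subst h
      exact iff_of_true rfl (slot_y_x (hij.resolve_right fun h => h rfl))
    · exact iff_of_false h (slot_ne hN12 (hτ.ne h)).2.2
  have key : ∀ v w, v ≠ w → (∀ j, τ j = 2 → ¬ (v = .y j ∧ w = .x j) ∧ ¬ (v = .x j ∧ w = .y j)) →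
      ((BAL k H).Adj v w ↔ L v ≤ R w ∧ L w ≤ R v) := by
    have sw : ∀ v w, ((BAL k H).Adj v w ↔ L v ≤ R w ∧ L w ≤ R v) →
        ((BAL k H).Adj w v ↔ L w ≤ R v ∧ L v ≤ R w) := fun v w h => by
      rw [SimpleGraph.adj_comm, h, and_comm]
    have zi : ∀ i w, ((BAL k H).Adj .z (.inner i w) ↔ _) := fun i w =>
      iff_of_true BAL_adj_z_inner (show L .z ≤ R (.inner i w) ∧ L (.inner i w) ≤ R .z from
        hmeet i w)
    have zy : ∀ j, ((BAL k H).Adj .z (.y j) ↔ _) := fun j =>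
      iff_of_true BAL_adj_z_y (show L .z ≤ R (.y j) ∧ L (.y j) ≤ R .z from
        (slot_y_z hN12 (τ j)).1)
    have zx : ∀ j, ((BAL k H).Adj .z (.x j) ↔ L .z ≤ R (.x j) ∧ L (.x j) ≤ R .z) := fun j =>
      iff_of_false BAL_not_adj_z_x fun h => by
        rcases slot_x_z (N := N) (τ j) with h' | h'
        · exact h'.not_ge h.1
        · exact h'.not_ge h.2
    have iy : ∀ i w j, ((BAL k H).Adj (.inner i w) (.y j) ↔
        L (.inner i w) ≤ R (.y j) ∧ L (.y j) ≤ R (.inner i w)) := fun i w j =>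
      iff_of_false BAL_not_adj_inner_y (hfree i w j).1
    have ix : ∀ i w j, ((BAL k H).Adj (.inner i w) (.x j) ↔
        L (.inner i w) ≤ R (.x j) ∧ L (.x j) ≤ R (.inner i w)) := fun i w j =>
      iff_of_false BAL_not_adj_inner_x (hfree i w j).2
    rintro (_ | ⟨i, w⟩ | j | j) (_ | ⟨i', w'⟩ | j' | j') hvw hpair
    · exact (hvw rfl).elim
    · exact zi i' w'
    · exact zy j'
    · exact zx j'
    · exact sw _ _ (zi i w)
    · by_cases h : i = i'
      · subst h
        rw [BAL_adj_inner_inner]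
        exact hself i w w' fun h => hvw (h ▸ rfl)
      · refine iff_of_false (BAL_not_adj_inner_inner h) fun h' => ?_
        have h1 := hwin i w
        have h2 := hwin i' w'
        have h3 : lo i w ≤ hi i' w' := h'.1
        have h4 : lo i' w' ≤ hi i w := h'.2
        rcases hsep i i' h with h5 | h5 <;> linarith
    · exact iy i w j'
    · exact ix i w j'
    · exact sw _ _ (zy j)
    · exact sw _ _ (iy i' w' j)
    · exact iff_of_false BAL_not_adj_y_y (slot_ne hN12 (hτ.ne fun h => hvw (by rw [h]))).1
    · refine hyx j j' ?_
      by_contra! h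
      exact (hpair j h.1).1 ⟨rfl, h.2 ▸ rfl⟩
    · exact sw _ _ (zx j)
    · exact sw _ _ (ix i' w' j)
    · refine sw _ _ (hyx j' j ?_)
      by_contra! h
      exact (hpair j (h.2 ▸ h.1)).2 ⟨rfl, h.2 ▸ rfl⟩
    · exact iff_of_false BAL_not_adj_x_x (slot_ne hN12 (hτ.ne fun h => hvw (by rw [h]))).2.1
  have hz : ∀ v, v ≠ .z → ¬ (L v ≤ L .z ∧ R .z ≤ R v) := by
    rintro (_ | ⟨i, w⟩ | j | j) hv h
    · exact hv rfl
    · have h1 := hwin i w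
      have h2 : lo i w ≤ -N := h.1
      have h3 : N ≤ hi i w := h.2
      linarith
    · exact (slot_y_z hN12 (τ j)).2.1 h
    · rcases slot_x_z (N := N) (τ j) with h' | h'
      · have h3 : N ≤ (slot N (τ j)).xr := h.2
        linarith
      · have h3 : (slot N (τ j)).xl ≤ -N := h.1
        linarith
  have hend : ∀ i w, (eL = some i ∨ eR = some i) → 0 < r i w →
      ¬ (L .z ≤ L (.inner i w) ∧ R (.inner i w) ≤ R .z) := by
    intro i w hi' hw h
    have h1 : -N ≤ lo i w := h.1
    have h2 : hi i w ≤ N := h.2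
    rcases hi' with h' | h'
    · linarith [(hL i h').2 w]
    · linarith [(hR i h').2 w]
  refine ⟨{v | v ≠ .z ∧ L .z ≤ L v ∧ R v ≤ R .z}, ?_, ?_, ?_, ?_, ?_⟩
  · intro S q hS hW hq hZ
    refine imp_le_of_endpoints S L R hLR' (fun v hv w hw hvw => key v w hvw fun j hj => ?_) ?_
    · constructor
      · rintro ⟨rfl, rfl⟩
        exact (hS j hj).elim (fun h => h hw) fun h => h hv
      · rintro ⟨rfl, rfl⟩
        exact (hS j hj).elim (fun h => h hv) fun h => h hw
    · have hcont : ∀ v w, L v ≤ L w → R w ≤ R v → L v ≤ R w ∧ L w ≤ R v := fun v w h h' =>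
        ⟨h.trans (hLR' w), (hLR' w).trans h'⟩
      rintro (_ | ⟨i, w⟩ | j | j) hv
      · refine (Set.ncard_le_ncard ?_ (Set.toFinite _)).trans (hZ hv)
        rintro u ⟨h1, h2, h3, h4⟩
        exact ⟨⟨h2, h3, h4⟩, h1⟩
      · have hsub : {u | u ∈ S ∧ u ≠ .inner i w ∧ L (.inner i w) ≤ L u ∧ R u ≤ R (.inner i w)} ⊆
            balPiece W k i \ {.inner i w} := by
          rintro u ⟨h1, h2, h3, h4⟩
          refine ⟨?_, h2⟩
          have hu := (key (.inner i w) u h2.symm (fun j _ => ⟨by simp, by simp⟩)).2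
            (hcont (.inner i w) u h3 h4)
          rcases u with _ | ⟨i', w'⟩ | j | j
          · exact (hz (.inner i w) (by simp) ⟨h3, h4⟩).elim
          · obtain rfl : i = i' := by
              by_contra h
              exact BAL_not_adj_inner_inner h hu
            exact ⟨w', rfl⟩
          · exact (BAL_not_adj_inner_y hu).elim
          · exact (BAL_not_adj_inner_x hu).elim
        have h1 := Set.ncard_le_ncard hsub (Set.toFinite _)
        have h2 := Set.ncard_sdiff_singleton_add_one (s := balPiece W k i)
          (a := .inner i w) ⟨w, rfl⟩ (Set.toFinite _)
        rw [ncard_balPiece] at h2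
        have := hW i
        omega
      · have hq1 := hq (Nat.ne_of_gt (Fin.pos j))
        refine (Set.ncard_le_ncard (t := {.x j}) ?_ (Set.toFinite _)).trans (by simpa using hq1)
        rintro u ⟨h1, h2, h3, h4⟩
        by_contra hux
        have hu := (key (.y j) u h2.symm (fun j' _ => ⟨?_, by simp⟩)).2 (hcont (.y j) u h3 h4)
        · rcases u with _ | ⟨i', w'⟩ | j' | j'
          · exact hz (.y j) (by simp) ⟨h3, h4⟩
          · exact BAL_not_adj_inner_y hu.symm
          · exact BAL_not_adj_y_y hu
          · exact hux (by rw [BAL_adj_y_x.1 hu]; rfl)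
        · rintro ⟨h, rfl⟩
          cases h
          exact hux rfl
      · have hq1 := hq (Nat.ne_of_gt (Fin.pos j))
        refine (Set.ncard_le_ncard (t := {.y j}) ?_ (Set.toFinite _)).trans (by simpa using hq1)
        rintro u ⟨h1, h2, h3, h4⟩
        by_contra hux
        have hu := (key (.x j) u h2.symm (fun j' _ => ⟨by simp, ?_⟩)).2 (hcont (.x j) u h3 h4)
        · rcases u with _ | ⟨i', w'⟩ | j' | j'
          · exact hz (.x j) (by simp) ⟨h3, h4⟩
          · exact BAL_not_adj_inner_x hu.symm
          · exact hux (by rw [← BAL_adj_y_x.1 hu.symm]; rfl)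
          · exact BAL_not_adj_x_x hu
        · rintro ⟨h, rfl⟩
          cases h
          exact hux rfl
  · rintro (_ | ⟨i, w⟩ | j | j) ⟨h1, h2, h3⟩
    · exact (h1 rfl).elim
    · exact .inl mem_balInner
    · refine .inr ⟨j, ?_, rfl⟩
      by_contra h
      exact (slot_y_z hN12 (τ j)).2.2 h ⟨h2, h3⟩
    · have h4 : -N ≤ (slot N (τ j)).xl := h2
      have h5 : (slot N (τ j)).xr ≤ N := h3
      have := (slot_le N (τ j)).2
      rcases slot_x_z (N := N) (τ j) with h' | h' <;> linarith
  · intro i hi' htop' w hw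
    exact hend i w hi' (htop i htop' w) hw.2
  · intro i hi' hc h2
    obtain ⟨v, w, hvw, hv, hw⟩ := hconn i hc h2
    exact ⟨v, w, hvw, fun h => hend i v hi' hv h.2, fun h => hend i w hi' hw h.2⟩
  · intro h
    exact ⟨.ofEndpoints L R hLR' fun v w hvw => key v w hvw fun j hj => (h j hj).elim⟩

end BAL
section Converse

variable {n : ℕ} {W : Fin n → Type u} {k : ℕ} {H : ∀ i, SimpleGraph (W i)}

/-- The bounds for `BAL` from which a graph isomorphic to it is balanced and `p`-critical. -/
theorem isCritical_and_isBalanced [∀ i, Finite (W i)] {V : Type u} [Finite V] {G : SimpleGraph V}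
    (φ : G ≃g BAL k H) {m p : ℕ} (hm : ∀ i, Nat.card (W i) ≤ m) (hp : 0 < p)
    (hcard : p + (2 - k) * m ≤ (balInner W k).ncard) (hI : IsIntervalGraph (BAL k H))
    (himp : imp ((BAL k H).induce Set.univ) ≤ p)
    (hdel : ∀ v, imp ((BAL k H).induce {v}ᶜ) ≤ p - 1) : IsCritical G p ∧ IsBalanced G := by
  have hGI : IsIntervalGraph G := hI.of_embedding φ.toEmbedding
  have hconn : G.Connected := φ.connected_iff.2 BAL_connected
  have hle : imp G ≤ p := by
    refine (imp_le_of_embedding hI φ.toEmbedding).trans (le_trans ?_ himp)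
    exact imp_le_of_embedding (hI.of_embedding (SimpleGraph.Embedding.induce _))
      (SimpleGraph.induceUnivIso (BAL k H)).symm.toEmbedding
  let c : BalVertex W k → Option (Fin n) ⊕ Fin k := fun v =>
    match v with
    | .z => .inl none
    | .inner i w => .inl (some i)
    | .y j => .inr j
    | .x j => .inr j
  have hz : ∀ v, v ≠ φ.symm .z ↔ φ v ≠ .z := fun v => not_congr (Equiv.eq_symm_apply φ.toEquiv)
  have hwt : (balInner W k).ncard ≤ wtAt G (φ.symm .z) + (2 - k) * m := by
    have h := ncard_le_wtAt_add (G := G) (z := φ.symm .z) (m := m) (fun v => c (φ v)) ?_ ?_ ?_ ?_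
    · refine le_trans ?_ h
      rw [← Set.ncard_image_of_injective _ φ.symm.injective]
      refine Set.ncard_le_ncard ?_ (Set.toFinite _)
      rintro _ ⟨v, hv, rfl⟩
      obtain ⟨i, w, rfl⟩ := Set.mem_iUnion.1 hv
      exact ⟨by rw [hz, φ.apply_symm_apply]; simp, some i, by simp [c]⟩
    · intro v w hv hw hvw
      rw [hz] at hv hw
      rw [← φ.map_adj_iff] at hvw
      revert hv hw hvw
      change φ v ≠ .z → φ w ≠ .z → (BAL k H).Adj (φ v) (φ w) → c (φ v) = c (φ w)
      generalize φ v = v'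
      generalize φ w = w'
      rcases v' with _ | ⟨i, a⟩ | j | j <;> rcases w' with _ | ⟨i', a'⟩ | j' | j' <;>
        intro hv hw hvw
      case inner.inner =>
        by_cases h : i = i'
        · exact congrArg (fun i => Sum.inl (some i)) h
        · exact (BAL_not_adj_inner_inner h hvw).elim
      case inner.y => exact (BAL_not_adj_inner_y hvw).elim
      case inner.x => exact (BAL_not_adj_inner_x hvw).elim
      case y.inner => exact (BAL_not_adj_inner_y hvw.symm).elim
      case x.inner => exact (BAL_not_adj_inner_x hvw.symm).elim
      case y.y => exact (BAL_not_adj_y_y hvw).elim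
      case x.x => exact (BAL_not_adj_x_x hvw).elim
      case y.x => rw [BAL_adj_y_x.1 hvw]
      case x.y => rw [BAL_adj_y_x.1 hvw.symm]
      all_goals exact absurd rfl (by assumption)
    · intro v i hv hi
      rw [hz] at hv
      rw [← φ.map_adj_iff, φ.apply_symm_apply]
      change c (φ v) = .inl i at hi
      revert hv hi
      generalize φ v = v'
      rcases v' with _ | ⟨i, a⟩ | j | j <;> intro hv hi
      · exact (hv rfl).elim
      · exact BAL_adj_z_inner
      · cases hi
      · cases hi
    · rintro (_ | i)
      · rw [Set.eq_empty_of_forall_notMem (s := {v | _ ∧ _}), Set.ncard_empty]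
        · exact Nat.zero_le _
        · rintro v ⟨hv, hi⟩
          rw [hz] at hv
          change c (φ v) = .inl none at hi
          revert hv hi
          generalize φ v = v'
          rcases v' with _ | ⟨i, a⟩ | j | j <;> intro hv hi
          · exact hv rfl
          all_goals cases hi
      · refine le_trans ?_ (hm i)
        rw [← ncard_balPiece (k := k), ← Set.ncard_image_of_injective _ φ.injective]
        refine Set.ncard_le_ncard ?_ (Set.toFinite _)
        rintro _ ⟨v, ⟨-, hi⟩, rfl⟩
        change c (φ v) = .inl (some i) at hi
        revert hi
        generalize φ v = v'
        rcases v' with _ | ⟨i, a⟩ | j | j <;> intro hi <;> cases hi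
        exact ⟨a, rfl⟩
    · intro j
      refine ⟨φ.symm (.x j), by rw [hz, φ.apply_symm_apply]; simp, by simp [c], ?_, ?_⟩
      · rw [φ.symm.map_adj_iff]
        exact BAL_not_adj_z_x
      · intro w _ hi
        have hwx : w = φ.symm (.x j) ↔ φ w = .x j := Equiv.eq_symm_apply φ.toEquiv
        rw [← φ.map_adj_iff, φ.apply_symm_apply, hwx]
        change c (φ w) = .inr j at hi
        revert hi
        generalize φ w = w'
        rcases w' with _ | ⟨i, a⟩ | j | j <;> intro hi <;> cases hi
        · exact .inr (BAL_adj_y_x.2 rfl)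
        · exact .inl rfl
  have h1 := wtAt_le_wt G (φ.symm .z)
  have h2 := wt_le_imp hconn hGI
  refine ⟨⟨hp, hGI, by omega, fun S hS => ?_⟩, hGI, by omega⟩
  obtain ⟨v, hv⟩ := (Set.ne_univ_iff_exists_notMem S).1 hS
  let f : G.induce S ↪g (BAL k H).induce {φ v}ᶜ :=
    { toFun := fun s => ⟨φ s, fun h => hv (φ.injective h ▸ s.2)⟩
      inj' := fun s t h => Subtype.ext (φ.injective (congrArg Subtype.val h))
      map_rel_iff' := φ.map_rel_iff }
  have h3 := imp_le_of_embedding (hI.of_embedding (SimpleGraph.Embedding.induce _)) f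
  have h4 := hdel (φ v)
  omega

theorem ncard_balInner_sdiff_pair [∀ i, Finite (W i)] {i j : Fin n} (h : i ≠ j) :
    (balInner W k \ (balPiece W k i ∪ balPiece W k j)).ncard + (Nat.card (W i) + Nat.card (W j)) =
      (balInner W k).ncard := by
  rw [← ncard_balPiece (k := k) i, ← ncard_balPiece (k := k) j,
    ← Set.ncard_union_eq (disjoint_balPiece h) (Set.toFinite _) (Set.toFinite _)]
  exact Set.ncard_sdiff_add_ncard_of_subset
    (Set.union_subset (balPiece_subset i) (balPiece_subset j)) (Set.toFinite _)

theorem ncard_balInner_sdiff [∀ i, Finite (W i)] (i : Fin n) :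
    (balInner W k \ balPiece W k i).ncard + Nat.card (W i) = (balInner W k).ncard := by
  rw [← ncard_balPiece (k := k) i]
  exact Set.ncard_sdiff_add_ncard_of_subset (balPiece_subset i) (Set.toFinite _)

theorem not_mem_balPiece {i j : Fin n} (h : i ≠ j) (w : W i) :
    (.inner i w : BalVertex W k) ∉ balPiece W k j := by
  rintro ⟨w', hw'⟩
  cases hw'
  exact h rfl

theorem ncard_inter_compl_le {α : Type*} [Finite α] {Z B : Set α} {v : α} (h : Z ⊆ B)
    (hv : v ∈ B) : (Z ∩ {v}ᶜ).ncard ≤ B.ncard - 1 := by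
  rw [← Set.ncard_sdiff_singleton_of_mem hv]
  exact Set.ncard_le_ncard (fun w hw => ⟨h hw.1, hw.2⟩) (Set.toFinite _)

theorem subset_balInner {τ : Fin k → Fin 3} (hτ : ∀ j, τ j ≠ 2) {Z : Set (BalVertex W k)}
    (hZ : ∀ v ∈ Z, v ∈ balInner W k ∨ ∃ j, τ j = 2 ∧ v = .y j) : Z ⊆ balInner W k := by
  intro v hv
  rcases hZ v hv with h | ⟨j, hj, -⟩
  · exact h
  · exact (hτ j hj).elim

theorem disjoint_balPiece_of_top {i : Fin n} {Z : Set (BalVertex W k)}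
    (hZ : ∀ w, .inner i w ∉ Z) : ∀ v ∈ Z, v ∉ balPiece W k i := by
  rintro _ hv ⟨w, rfl⟩
  exact hZ w hv

theorem isCritical_BAL_zero {V : Type u} [Finite V] {G : SimpleGraph V}
    (hH : IsConnIntervalSeq H) (hmax : HasMaxCliques H 3) (φ : G ≃g BAL 0 H) :
    ∃ p, IsCritical G p ∧ IsBalanced G := by
  have : ∀ i, Finite (W i) := fun i => (hH i).1
  obtain ⟨s, hs, hsm⟩ := hmax
  obtain ⟨i₁, hi₁⟩ : s.Nonempty := Finset.card_pos.1 (by omega)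
  obtain ⟨m, hm⟩ : ∃ m, m = Nat.card (W i₁) := ⟨_, rfl⟩
  have hcard : ∀ i ∈ s, Nat.card (W i) = m := fun i hi =>
    hm ▸ le_antisymm ((hsm i₁ hi₁).2 i) ((hsm i hi).2 i₁)
  have hle : ∀ i, Nat.card (W i) ≤ m := fun i => hm ▸ (hsm i₁ hi₁).2 i
  have hpos : 0 < m := by
    have := (hH i₁).2.1.nonempty
    rw [hm]
    exact Nat.card_pos
  have hplace : ∀ i ∈ s, ∀ j ∈ s, i ≠ j → ∃ Z : Set (BalVertex W 0),
      (∀ (S : Set (BalVertex W 0)) (q : ℕ), m ≤ q + 1 → (.z ∈ S → (Z ∩ S).ncard ≤ q) →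
        imp ((BAL 0 H).induce S) ≤ q) ∧
      Z ⊆ balInner W 0 \ (balPiece W 0 i ∪ balPiece W 0 j) ∧ IsIntervalGraph (BAL 0 H) := by
    intro i hi j hj hij
    obtain ⟨Z, h1, h2, h3, -, h5⟩ := exists_placement (k := 0) (fun i => (hH i).2.2) (some i)
      (some j) (fun a ha hb => hij (Option.some_injective _ (ha.trans hb.symm))) Fin.elim0
      (fun a => a.elim0) (fun a => a.elim0) (fun a => a.elim0)
    refine ⟨Z, fun S q hq hZ => h1 S q (fun a => a.elim0) (fun a => (hle a).trans hq)
      (fun h => (h rfl).elim) hZ, fun v hv => ⟨subset_balInner (fun a => a.elim0) h2 hv, ?_⟩,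
      h5 fun a => a.elim0⟩
    rintro (h | h)
    · exact disjoint_balPiece_of_top (h3 i (.inl rfl) (hsm i hi).1) v hv h
    · exact disjoint_balPiece_of_top (h3 j (.inr rfl) (hsm j hj).1) v hv h
  have hsize : ∀ i ∈ s, ∀ j ∈ s, i ≠ j →
      (balInner W 0 \ (balPiece W 0 i ∪ balPiece W 0 j)).ncard + 2 * m =
        (balInner W 0).ncard := by
    intro i hi j hj hij
    rw [← ncard_balInner_sdiff_pair hij, hcard i hi, hcard j hj]
    omega
  have hother : ∀ i, ∃ a ∈ s, ∃ b ∈ s, a ≠ b ∧ a ≠ i ∧ b ≠ i := by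
    intro i
    have := Finset.pred_card_le_card_erase (s := s) (a := i)
    obtain ⟨a, ha, b, hb, hab⟩ := Finset.one_lt_card.1 (show 1 < (s.erase i).card by omega)
    rw [Finset.mem_erase] at ha hb
    exact ⟨a, ha.2, b, hb.2, hab, ha.1, hb.1⟩
  obtain ⟨a, ha, b, hb, hab, ha₁, hb₁⟩ := hother i₁
  obtain ⟨Z, hZ, hZsub, hI⟩ := hplace a ha b hb hab
  obtain ⟨p, hp⟩ : ∃ p, p + 2 * m = (balInner W 0).ncard := ⟨_, hsize a ha b hb hab⟩
  have hpm : m ≤ p := by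
    have h1 : balPiece W 0 i₁ ⊆ balInner W 0 \ (balPiece W 0 a ∪ balPiece W 0 b) := by
      rintro _ ⟨w, rfl⟩
      refine ⟨mem_balInner, ?_⟩
      rintro (h | h)
      · exact not_mem_balPiece ha₁.symm w h
      · exact not_mem_balPiece hb₁.symm w h
    have h2 := Set.ncard_le_ncard h1 (Set.toFinite _)
    rw [ncard_balPiece, ← hm] at h2
    have := hsize a ha b hb hab
    omega
  refine ⟨p, isCritical_and_isBalanced φ hle (by omega) (by omega) hI ?_ ?_⟩
  · refine hZ _ _ (by omega) fun _ => ?_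
    rw [Set.inter_univ]
    have := Set.ncard_le_ncard hZsub (Set.toFinite _)
    have := hsize a ha b hb hab
    omega
  · rintro (_ | ⟨i, w⟩ | j | j)
    · exact hZ _ _ (by omega) fun h => (h rfl).elim
    · obtain ⟨a, ha, b, hb, hab, hai, hbi⟩ := hother i
      obtain ⟨Z, hZ, hZsub, -⟩ := hplace a ha b hb hab
      refine hZ _ _ (by omega) fun _ => ?_
      have h1 := ncard_inter_compl_le hZsub (v := .inner i w) ⟨mem_balInner, by
        rintro (h | h)
        · exact not_mem_balPiece hai.symm w h
        · exact not_mem_balPiece hbi.symm w h⟩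
      have := hsize a ha b hb hab
      omega
    · exact j.elim0
    · exact j.elim0

theorem isCritical_BAL_one {V : Type u} [Finite V] {G : SimpleGraph V}
    (hH : IsConnIntervalSeq H) (htwo : MaxOrderGeTwo W) (hmax : HasMaxCliques H 2)
    (φ : G ≃g BAL 1 H) : ∃ p, IsCritical G p ∧ IsBalanced G := by
  have : ∀ i, Finite (W i) := fun i => (hH i).1
  obtain ⟨s, hs, hsm⟩ := hmax
  obtain ⟨a, b, hab, rfl⟩ := Finset.card_eq_two.1 hs
  obtain ⟨htopa, hmaxa⟩ := hsm a (by simp)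
  obtain ⟨htopb, hmaxb⟩ := hsm b (by simp)
  obtain ⟨m, hm⟩ : ∃ m, m = Nat.card (W a) := ⟨_, rfl⟩
  have hmb : Nat.card (W b) = m := hm ▸ le_antisymm (hmaxa b) (hmaxb a)
  have hle : ∀ i, Nat.card (W i) ≤ m := hm ▸ hmaxa
  have hm2 : 2 ≤ m := by
    obtain ⟨i, hi⟩ := htwo
    exact hi.trans (hle i)
  have hplace : ∀ i, H i = ⊤ → ∃ Z : Set (BalVertex W 1),
      (∀ (S : Set (BalVertex W 1)) (q : ℕ), m ≤ q + 1 → 1 ≤ q → (.z ∈ S → (Z ∩ S).ncard ≤ q) →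
        imp ((BAL 1 H).induce S) ≤ q) ∧
      Z ⊆ balInner W 1 \ balPiece W 1 i ∧ IsIntervalGraph (BAL 1 H) := by
    intro i hi
    have h02 : ∀ j : Fin 1, (fun _ => 0 : Fin 1 → Fin 3) j ≠ 2 := fun j => by simp
    obtain ⟨Z, h1, h2, h3, -, h5⟩ := exists_placement (k := 1) (fun i => (hH i).2.2) none
      (some i) (by simp) (fun _ => 0) (Function.injective_of_subsingleton _) (by simp) (by simp)
    refine ⟨Z, fun S q hq hq1 hZ => h1 S q (fun j hj => (h02 j hj).elim)
      (fun a => (hle a).trans hq) (fun _ => hq1) hZ, fun v hv => ⟨subset_balInner h02 h2 hv, ?_⟩,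
      h5 h02⟩
    exact disjoint_balPiece_of_top (h3 i (.inr rfl) hi) v hv
  have hsize := ncard_balInner_sdiff_pair (W := W) (k := 1) hab
  have hsizea := ncard_balInner_sdiff (W := W) (k := 1) a
  have hsizeb := ncard_balInner_sdiff (W := W) (k := 1) b
  rw [← hm] at hsizea hsize
  rw [hmb] at hsizeb hsize
  obtain ⟨p, hp⟩ : ∃ p, p + m = (balInner W 1).ncard := ⟨_, hsizea⟩
  obtain ⟨Z, hZ, hZsub, hI⟩ := hplace a htopa
  have hx : ∀ S : Set (BalVertex W 1), (.x 0 ∉ S ∨ .y 0 ∉ S) →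
      imp ((BAL 1 H).induce S) ≤ p - 1 := by
    intro S hS
    obtain ⟨Z, h1, h2, h3, -, -⟩ := exists_placement (k := 1) (fun i => (hH i).2.2) (some a)
      (some b) (fun i h h' => hab (Option.some_injective _ (h.trans h'.symm))) (fun _ => 2)
      (Function.injective_of_subsingleton _) (by simp) (by simp)
    refine h1 S _ (fun j _ => by rwa [Subsingleton.elim j 0])
      (fun i => (hle i).trans (by omega)) (fun _ => by omega) fun _ => ?_
    have hsub : Z ∩ S ⊆ insert (.y 0) (balInner W 1 \ (balPiece W 1 a ∪ balPiece W 1 b)) := by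
      rintro v ⟨hv, -⟩
      rcases h2 v hv with h | ⟨j, -, rfl⟩
      · refine .inr ⟨h, ?_⟩
        rintro (h' | h')
        · exact disjoint_balPiece_of_top (h3 a (.inl rfl) htopa) v hv h'
        · exact disjoint_balPiece_of_top (h3 b (.inr rfl) htopb) v hv h'
      · exact .inl (by rw [Subsingleton.elim j 0])
    have h4 := (Set.ncard_le_ncard hsub (Set.toFinite _)).trans (Set.ncard_insert_le _ _)
    omega
  refine ⟨p, isCritical_and_isBalanced φ hle (by omega) (by omega) hI ?_ ?_⟩
  · refine hZ _ _ (by omega) (by omega) fun _ => ?_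
    rw [Set.inter_univ]
    have := Set.ncard_le_ncard hZsub (Set.toFinite _)
    omega
  · rintro (_ | ⟨i, w⟩ | j | j)
    · exact hZ _ _ (by omega) (by omega) fun h => (h rfl).elim
    · obtain ⟨c, hc, hci, hcs⟩ : ∃ c, H c = ⊤ ∧ i ≠ c ∧
          (balInner W 1 \ balPiece W 1 c).ncard + m = (balInner W 1).ncard := by
        by_cases h : i = a
        · exact ⟨b, htopb, h ▸ hab, hsizeb⟩
        · exact ⟨a, htopa, h, hsizea⟩
      obtain ⟨Z, hZ, hZsub, -⟩ := hplace c hc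
      refine hZ _ _ (by omega) (by omega) fun _ => ?_
      have h1 := ncard_inter_compl_le hZsub (v := .inner i w)
        ⟨mem_balInner, not_mem_balPiece hci w⟩
      omega
    · exact hx _ (.inr (by rw [Subsingleton.elim j 0]; simp))
    · exact hx _ (.inl (by rw [Subsingleton.elim j 0]; simp))

theorem isCritical_BAL_two {V : Type u} [Finite V] {G : SimpleGraph V}
    (hH : IsConnIntervalSeq H) (htwo : MaxOrderGeTwo W) (φ : G ≃g BAL 2 H) :
    ∃ p, IsCritical G p ∧ IsBalanced G := by
  have : ∀ i, Finite (W i) := fun i => (hH i).1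
  obtain ⟨a, ha⟩ := htwo
  obtain ⟨p, hp⟩ : ∃ p, p = (balInner W 2).ncard := ⟨_, rfl⟩
  have hle : ∀ i, Nat.card (W i) ≤ p := by
    intro i
    rw [hp, ← ncard_balPiece (k := 2)]
    exact Set.ncard_le_ncard (balPiece_subset i) (Set.toFinite _)
  have hp2 : 2 ≤ p := ha.trans (hle a)
  have h02 : ∀ j : Fin 2, (![0, 1] : Fin 2 → Fin 3) j ≠ 2 := by decide
  obtain ⟨Z, h1, h2, -, -, hI⟩ := exists_placement (k := 2) (fun i => (hH i).2.2) none none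
    (by simp) ![0, 1] (by decide) (by simp) (by simp)
  have hZsub := subset_balInner h02 h2
  have hx : ∀ (S : Set (BalVertex W 2)) (τ : Fin 2 → Fin 3) (j : Fin 2),
      Function.Injective τ → (∀ i, τ i ≠ 1) → (∀ i, τ i = 2 ↔ i = j) →
      (.x j ∉ S ∨ .y j ∉ S) → imp ((BAL 2 H).induce S) ≤ p - 1 := by
    intro S τ j hτ hτ1 hτ2 hS
    obtain ⟨Z, h1, h2, -, h4, -⟩ := exists_placement (k := 2) (fun i => (hH i).2.2) none
      (some a) (by simp) τ hτ (by simp) fun i h => (hτ1 i h).elim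
    obtain ⟨u, v, huv, hu, hv⟩ := h4 a (.inr rfl) (hH a).2.1 ha
    refine h1 S _ (fun i hi => (hτ2 i).1 hi ▸ hS) (fun i => (hle i).trans (by omega))
      (fun _ => by omega) fun _ => ?_
    have hpair : ({.inner a u, .inner a v} : Set (BalVertex W 2)).ncard = 2 :=
      Set.ncard_pair fun h => huv (by simpa using h)
    have hsub : Z ∩ S ⊆ insert (.y j) (balInner W 2 \ {.inner a u, .inner a v}) := by
      rintro t ⟨ht, -⟩
      rcases h2 t ht with h | ⟨i, hi, rfl⟩
      · refine .inr ⟨h, ?_⟩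
        rintro (rfl | rfl)
        · exact hu ht
        · exact hv ht
      · exact .inl (by rw [(hτ2 i).1 hi])
    have h5 := (Set.ncard_le_ncard hsub (Set.toFinite _)).trans (Set.ncard_insert_le _ _)
    have h6 := Set.ncard_sdiff_add_ncard_of_subset
      (s := {.inner a u, .inner a v}) (t := balInner W 2)
      (Set.insert_subset mem_balInner (Set.singleton_subset_iff.2 mem_balInner)) (Set.toFinite _)
    omega
  have hxj : ∀ (S : Set (BalVertex W 2)) (j : Fin 2), (.x j ∉ S ∨ .y j ∉ S) →
      imp ((BAL 2 H).induce S) ≤ p - 1 := fun S j =>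
    hx S (fun i => if i = j then 2 else 0) j (by revert j; decide) (by revert j; decide)
      (by revert j; decide)
  have hS : ∀ (S : Set (BalVertex W 2)) (j : Fin 2), (![0, 1] : Fin 2 → Fin 3) j = 2 →
      .x j ∉ S ∨ .y j ∉ S := fun _ j hj => (h02 j hj).elim
  refine ⟨p, isCritical_and_isBalanced φ hle (by omega) (by omega) (hI h02) ?_ ?_⟩
  · refine h1 _ _ (hS _) (fun i => (hle i).trans (by omega)) (fun _ => by omega) fun _ => ?_
    rw [Set.inter_univ, hp]
    exact Set.ncard_le_ncard hZsub (Set.toFinite _)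
  · rintro (_ | ⟨i, w⟩ | j | j)
    · exact h1 _ _ (hS _) (fun i => (hle i).trans (by omega)) (fun _ => by omega)
        fun h => (h rfl).elim
    · refine h1 _ _ (hS _) (fun i => (hle i).trans (by omega)) (fun _ => by omega) fun _ => ?_
      rw [hp]
      exact ncard_inter_compl_le hZsub mem_balInner
    · exact hxj _ j (.inr (by simp))
    · exact hxj _ j (.inl (by simp))

end Converse

end ImpInterval

theorem theorem4p1 {V : Type u} [Finite V] (G : SimpleGraph V) :
    (∃ p : ℕ, ImpInterval.IsCritical G p ∧ ImpInterval.IsBalanced G) ↔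
      ((∃ (n : ℕ) (W : Fin n → Type u) (H : ∀ i, SimpleGraph (W i)),
          ImpInterval.IsConnIntervalSeq H ∧ ImpInterval.HasMaxCliques H 3 ∧
          Nonempty (G ≃g ImpInterval.BAL 0 H)) ∨
       (∃ (n : ℕ) (W : Fin n → Type u) (H : ∀ i, SimpleGraph (W i)),
          ImpInterval.IsConnIntervalSeq H ∧ ImpInterval.MaxOrderGeTwo W ∧
          ImpInterval.HasMaxCliques H 2 ∧
          Nonempty (G ≃g ImpInterval.BAL 1 H)) ∨
       (∃ (n : ℕ) (W : Fin n → Type u) (H : ∀ i, SimpleGraph (W i)),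
          ImpInterval.IsConnIntervalSeq H ∧ ImpInterval.MaxOrderGeTwo W ∧
          Nonempty (G ≃g ImpInterval.BAL 2 H))) := by
  constructor
  · rintro ⟨p, hcrit, hbal⟩
    obtain ⟨k, hk, n, W, H, hH, htwo, hmax, hiso⟩ := ImpInterval.exists_iso_BAL hcrit hbal
    obtain rfl | rfl | rfl : k = 0 ∨ k = 1 ∨ k = 2 := by omega
    · exact .inl ⟨n, W, H, hH, hmax zero_le_one, hiso⟩
    · exact .inr (.inl ⟨n, W, H, hH, htwo le_rfl, hmax le_rfl, hiso⟩)
    · exact .inr (.inr ⟨n, W, H, hH, htwo one_le_two, hiso⟩)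
  · rintro (⟨n, W, H, hH, hmax, ⟨φ⟩⟩ | ⟨n, W, H, hH, htwo, hmax, ⟨φ⟩⟩ | ⟨n, W, H, hH, htwo, ⟨φ⟩⟩)
    · exact ImpInterval.isCritical_BAL_zero hH hmax φ
    · exact ImpInterval.isCritical_BAL_one hH htwo hmax φ
    · exact ImpInterval.isCritical_BAL_two hH htwo φ
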